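/- **Setting.** Let $G$ be an amenable Hausdorff topological group acting jointly continuously (from the left) on a compact metric space $(X,d)$; amenable means that the bounded functions $a$ on $G$ with $\sup_h|a(vh)-a(h)|\to0$ as $v\to e$ carry a left invariant mean. $C(X)$ denotes the real continuous functions on $X$. A sequence $(F_n)$ of subsets of $G$ with a Borel measure $\theta$ on $G$ is a * *thick left (right) Følner sequence* if $G$ is locally compact, $\theta$ is a left (right) Haar measure, the $F_n$ are non-empty and compact with $\theta(F_n)>0$, and $\theta(F_n\triangle KF_n)/\theta(F_n)\to 0$ (respectively $\theta(F_n\triangle F_nK)/\theta(F_n)\to0$) for every non-empty compact $K\subseteq G$; * *thin left (right) Følner sequence* if $\theta$ is the counting measure, the $F_n$ are non-empty and finite, and $\mathfrak m_V(F_n,gF_n)/|F_n|\to1$ (respectively $\mathfrak m_V(F_n,F_ng)/|F_n|\to 1$) for all $g\in G$ and all open neighbourhoods $V$ of the neutral element, where $\mathfrak m_V(F,E)$ is the maximal cardinality of a set $M\subseteq F$ that admits an injection $\phi:M\to E$ with $\phi(f)\in Vf$ for all $f\in M$; * *mirrored thin right Følner sequence* if the same holds with $F_ng$ and with $\phi(f)\in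 fV$ in place of $\phi(f)\in Vf$. Let $S_n^* \delta_x$ be the image of $\theta|_{F_n}/\theta(F_n)$ under $g\mapsto gx$. The system is *$(F_n)$-weakly mean equicontinuous* if $(x,y)\mapsto\limsup_{n} W(S_n^*\delta_x,S_n^*\delta_y)$ is continuous on $X^2$, where $W(\mu,\nu)=\inf_\iota\int d\,d\iota$ is the Wasserstein distance, the infimum being over all couplings $\iota$ of $\mu$ and $\nu$. A point $x$ is *$\mu$-generic along $(F_n)$* if $\frac1{\theta(F_n)}\int_{F_n}f(gx)\,d\theta(g)\to\int f\,d\mu$ for all $f\in C(X)$. An orbit closure is *uniquely ergodic* if it carries exactly one $G$-invariant Borel probability measure. **Theorem.** Let $\mathcal F$ be a left or right Følner sequence of any of the above kinds. (1) If $(X,G)$ is $\mathcal F$-weakly mean equicontinuous, then there are a subsequence $(F_n)$ of $\mathcal F$ and a bounded linear operator $S:C(X)\to C(X)$ with $$\lim_{n\to\infty}\frac1{\theta(F_n)}\int_{F_n}f(gx)\,d\theta(g)=Sf(x)\qquad(f\in C(X),\ x\in X).\tag{$*$}$$ (2) Conversely, let $(F_n)$ be $\mathcal F$ or any subsequence of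 it, and let $S$ be a bounded linear operator on $C(X)$ satisfying $(*)$. Then $(X,G)$ is $(F_n)$-weakly mean equicontinuous; $S$ is positive and contractive ($Sf\ge0$ if $f\ge0$, $S\mathbf 1\le\mathbf 1$, $\|S\|\le1$); and every $x\in X$ is $\mu_x$-generic along $(F_n)$ for a Borel probability measure $\mu_x$ with $Sf(x)=\int f\,d\mu_x$ for all $f\in C(X)$, the map $x\mapsto\mu_x$ being weak*-continuous. (3) In the situation of (2), assume that $G$ is locally compact in case $\mathcal F$ is only a mirrored thin right Følner sequence. Then $S$ is moreover a projection, $S^2=S$, and * (a) $S(f\,Sh)=S(Sf\,Sh)$ for all $f,h\in C(X)$ (Seever's identity); * (b) $S(f\,Sh)=Sf\,Sh$ for all $f,h\in C(X)$ ($S$ is an averaging operator) if and only if $\mu_x$ is ($G$-invariant and) ergodic for every $x\in X$; * (c) $T_gS=S$ for all $g\in G$, where $T_gf(x)=f(gx)$, if and only if every orbit closure $\overline{Gx}$, $x\in X$, is uniquely ergodic. -/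

import Mathlib

open MeasureTheory Filter Topology
open scoped Pointwise symmDiff BoundedContinuousFunction

namespace FolnerAverages

noncomputable section

/-! ### Amenability and Følner sequences -/

section Group

variable {G : Type*} [Group G] [TopologicalSpace G]

/-- A bounded continuous function `a` on `G` is right uniformly continuous if `a (v * h)` is close
to `a h`, uniformly in `h`, for `v` close to the neutral element. -/
def IsRightUniformlyContinuous (a : G →ᵇ ℝ) : Prop :=
  ∀ ε > 0, ∃ V ∈ 𝓝 (1 : G), ∀ v ∈ V, ∀ h : G, |a (v * h) - a h| < ε

/-- A topological group is amenable if there is a left invariant mean on its right uniformly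
continuous bounded functions. (A mean on this subspace always extends to a positive normalized
functional on all bounded continuous functions; invariance is only asked on the subspace.) -/
def IsAmenable (G : Type*) [Group G] [TopologicalSpace G] [IsTopologicalGroup G] : Prop :=
  ∃ m : (G →ᵇ ℝ) →ₗ[ℝ] ℝ,
    (∀ a : G →ᵇ ℝ, 0 ≤ a → 0 ≤ m a) ∧ m 1 = 1 ∧
    ∀ a : G →ᵇ ℝ, IsRightUniformlyContinuous a →
      ∀ g : G, m (a.compContinuous ⟨fun h => g * h, continuous_const_mul g⟩) = m a

/-- `θ` is a (regular) left Haar measure. -/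
def IsLeftHaar [MeasurableSpace G] [BorelSpace G] (θ : Measure G) : Prop :=
  θ.Regular ∧ θ.IsOpenPosMeasure ∧ θ.IsMulLeftInvariant

/-- `θ` is a (regular) right Haar measure. -/
def IsRightHaar [MeasurableSpace G] [BorelSpace G] (θ : Measure G) : Prop :=
  θ.Regular ∧ θ.IsOpenPosMeasure ∧ θ.IsMulRightInvariant

/-- Thick left Følner sequences in a locally compact group, with `θ` a left Haar measure. -/
structure IsThickLeftFolner [MeasurableSpace G] [BorelSpace G]
    (θ : Measure G) (F : ℕ → Set G) : Prop where
  locallyCompact : LocallyCompactSpace G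
  haar : IsLeftHaar θ
  isCompact : ∀ n, IsCompact (F n)
  nonempty : ∀ n, (F n).Nonempty
  pos : ∀ n, 0 < θ (F n)
  tendsto : ∀ K : Set G, IsCompact K → K.Nonempty →
    Tendsto (fun n => θ (F n ∆ (K * F n)) / θ (F n)) atTop (𝓝 0)

/-- Thick right Følner sequences in a locally compact group, with `θ` a right Haar measure. -/
structure IsThickRightFolner [MeasurableSpace G] [BorelSpace G]
    (θ : Measure G) (F : ℕ → Set G) : Prop where
  locallyCompact : LocallyCompactSpace G
  haar : IsRightHaar θ
  isCompact : ∀ n, IsCompact (F n)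
  nonempty : ∀ n, (F n).Nonempty
  pos : ∀ n, 0 < θ (F n)
  tendsto : ∀ K : Set G, IsCompact K → K.Nonempty →
    Tendsto (fun n => θ (F n ∆ (F n * K)) / θ (F n)) atTop (𝓝 0)

/-- The `V`-matching number of (finite) sets `F` and `E`: the maximal cardinality of a subset
`M ⊆ F` with an injection `φ : M → E` such that `φ f ∈ V f` for all `f ∈ M`. -/
def matchingNumber (V F E : Set G) : ℕ :=
  sSup {k | ∃ M ⊆ F, M.ncard = k ∧ ∃ φ : G → G,
    Set.InjOn φ M ∧ Set.MapsTo φ M E ∧ ∀ f ∈ M, φ f ∈ V * {f}}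

/-- The mirrored `V`-matching number, where `φ f ∈ f V` instead of `φ f ∈ V f`. -/
def mirroredMatchingNumber (V F E : Set G) : ℕ :=
  sSup {k | ∃ M ⊆ F, M.ncard = k ∧ ∃ φ : G → G,
    Set.InjOn φ M ∧ Set.MapsTo φ M E ∧ ∀ f ∈ M, φ f ∈ ({f} : Set G) * V}

/-- Thin left Følner sequences; the measure used for averaging is the counting measure. -/
structure IsThinLeftFolner [MeasurableSpace G] (θ : Measure G) (F : ℕ → Set G) : Prop where
  count : θ = Measure.count
  finite : ∀ n, (F n).Finite
  nonempty : ∀ n, (F n).Nonempty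
  tendsto : ∀ g : G, ∀ V : Set G, IsOpen V → (1 : G) ∈ V →
    Tendsto (fun n => (matchingNumber V (F n) ({g} * F n) : ℝ) / ((F n).ncard : ℝ)) atTop (𝓝 1)

/-- Thin right Følner sequences: `F n` is matched with its right translates `F n * g`, matched
elements `f`, `φ f` satisfying `φ f ∈ V f`. -/
structure IsThinRightFolner [MeasurableSpace G] (θ : Measure G) (F : ℕ → Set G) : Prop where
  count : θ = Measure.count
  finite : ∀ n, (F n).Finite
  nonempty : ∀ n, (F n).Nonempty
  tendsto : ∀ g : G, ∀ V : Set G, IsOpen V → (1 : G) ∈ V →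
    Tendsto (fun n => (matchingNumber V (F n) (F n * {g}) : ℝ) / ((F n).ncard : ℝ)) atTop (𝓝 1)

/-- Mirrored thin right Følner sequences: `F n` is matched with its right translates `F n * g`,
matched elements `f`, `φ f` satisfying `φ f ∈ f V`. Equivalently, `(F n)⁻¹` is thin left Følner. -/
structure IsMirroredThinRightFolner [MeasurableSpace G] (θ : Measure G) (F : ℕ → Set G) :
    Prop where
  count : θ = Measure.count
  finite : ∀ n, (F n).Finite
  nonempty : ∀ n, (F n).Nonempty
  tendsto : ∀ g : G, ∀ V : Set G, IsOpen V → (1 : G) ∈ V →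
    Tendsto (fun n => (mirroredMatchingNumber V (F n) (F n * {g}) : ℝ) / ((F n).ncard : ℝ))
      atTop (𝓝 1)

/-- Left or right Følner sequences of any kind, together with the averaging measure `θ`. -/
def IsFolner [MeasurableSpace G] [BorelSpace G] (θ : Measure G) (F : ℕ → Set G) : Prop :=
  IsThickLeftFolner θ F ∨ IsThickRightFolner θ F ∨ IsThinLeftFolner θ F ∨
    IsThinRightFolner θ F ∨ IsMirroredThinRightFolner θ F

/-- Left or right Følner sequences, where mirrored thin right ones are only admitted in locally
compact groups: beyond those, their averages need not be asymptotically invariant. -/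
def IsAdmissibleFolner [MeasurableSpace G] [BorelSpace G] (θ : Measure G) (F : ℕ → Set G) : Prop :=
  IsThickLeftFolner θ F ∨ IsThickRightFolner θ F ∨ IsThinLeftFolner θ F ∨
    IsThinRightFolner θ F ∨ (IsMirroredThinRightFolner θ F ∧ LocallyCompactSpace G)

end Group

/-! ### The Wasserstein distance -/

/-- The Wasserstein distance: infimum of `∫ d dι` over all joinings `ι` of `μ` with `ν`. -/
def wasserstein {X : Type*} [MetricSpace X] [MeasurableSpace X] (μ ν : Measure X) : ℝ :=
  ⨅ ι : {ι : Measure (X × X) // ι.map Prod.fst = μ ∧ ι.map Prod.snd = ν},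
    ∫ p, dist p.1 p.2 ∂(ι : Measure (X × X))

/-! ### Averages along orbits -/

section System

variable {G X : Type*} [Group G] [TopologicalSpace G] [MeasurableSpace G]
  [MetricSpace X] [MulAction G X]

/-- `S_n f (x) = 1 / θ(F_n) * ∫_{F_n} f(g x) dθ(g)`. -/
def folnerAverage (θ : Measure G) (F : ℕ → Set G) (n : ℕ) (f : C(X, ℝ)) (x : X) : ℝ :=
  (θ.real (F n))⁻¹ * ∫ g in F n, f (g • x) ∂θ

/-- The measure `S_n^* δ_x`: the image of the normalized restriction of `θ` to `F_n` under
`g ↦ g x`. -/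
def orbitMeasure [MeasurableSpace X] (θ : Measure G) (F : ℕ → Set G) (n : ℕ) (x : X) : Measure X :=
  ((θ (F n))⁻¹ • θ.restrict (F n)).map (fun g => g • x)

/-- The pseudometric `limsup_n W(S_n^* δ_x, S_n^* δ_y)`. -/
def folnerPseudometric [MeasurableSpace X] (θ : Measure G) (F : ℕ → Set G) (x y : X) : ℝ :=
  limsup (fun n => wasserstein (orbitMeasure θ F n x) (orbitMeasure θ F n y)) atTop

/-- The system on `X` is weakly mean equicontinuous with respect to `F`. -/
def IsWeaklyMeanEquicontinuous (X : Type*) [MetricSpace X] [MulAction G X] [MeasurableSpace X]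
    (θ : Measure G) (F : ℕ → Set G) : Prop :=
  Continuous (fun p : X × X => folnerPseudometric θ F p.1 p.2)

/-- Pointwise convergence of the averages along `F` to the operator `S`. -/
def AveragesTendsto [CompactSpace X] (θ : Measure G) (F : ℕ → Set G)
    (S : C(X, ℝ) →L[ℝ] C(X, ℝ)) : Prop :=
  ∀ (f : C(X, ℝ)) (x : X), Tendsto (fun n => folnerAverage θ F n f x) atTop (𝓝 (S f x))

/-- The point `x` is `μ`-generic along `F`. -/
def IsGeneric [MeasurableSpace X] (θ : Measure G) (F : ℕ → Set G) (x : X) (μ : Measure X) : Prop :=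
  ∀ f : C(X, ℝ), Tendsto (fun n => folnerAverage θ F n f x) atTop (𝓝 (∫ y, f y ∂μ))

end System

/-- The Koopman operator `T_g f = f ∘ g`. -/
def koopman {G X : Type*} [Group G] [TopologicalSpace G] [TopologicalSpace X] [MulAction G X]
    [ContinuousSMul G X] (g : G) (f : C(X, ℝ)) : C(X, ℝ) :=
  f.comp ⟨fun x => g • x, continuous_const_smul g⟩

/-- The orbit closure of `x` is uniquely ergodic: it carries exactly one invariant Borel
probability measure. -/
def IsUniquelyErgodicOrbitClosure (G : Type*) {X : Type*} [Group G] [TopologicalSpace X]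
    [MulAction G X] [MeasurableSpace X] (x : X) : Prop :=
  ∃! μ : ProbabilityMeasure X,
    SMulInvariantMeasure G X (μ : Measure X) ∧
      (μ : Measure X) (closure (MulAction.orbit G x))ᶜ = 0

end

end FolnerAverages

set_option linter.unusedSectionVars false

namespace FolnerAverages

/-! ### Positive functionals and measures on compact spaces -/

section Riesz

variable {Y : Type*} [TopologicalSpace Y] [CompactSpace Y] [MeasurableSpace Y] [BorelSpace Y]

/-! (1) A continuous function on a compact metric space is Lipschitz up to a small error, so the
Wasserstein distance of two orbit measures controls the difference of the averages. Weak mean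
equicontinuity thus makes the averages asymptotically equicontinuous at each point, and a diagonal
subsequence over countable dense sets of functions and points converges everywhere, with continuous
limits (`exists_subseq_averagesTendsto`).

(2) The limit operator is positive and unital, so Riesz representation yields the measures `μ x`.
Kantorovich duality, proved by extending a positive functional, makes the Wasserstein distance
weakly continuous; hence the limsup pseudometric is the distance of `μ x` and `μ y`.

(3) Two facts suffice, recorded in `IsInvariantKernel`: every `μ x` is invariant, and `S` preserves
integrals against invariant measures. The second is Fubini. For left sequences the first is
immediate. For right sequences it is the functions `S f` that are invariant; an invariant measure on
the orbit closure, supplied by amenability, must then equal `μ x`. Mirrored sequences first require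
smoothing over a compact set with Haar measure. By Jensen's inequality `S` is an idempotent
contraction in L² of each invariant measure, hence an orthogonal projection: this is Seever's
identity. The averaging identity says that `S k` has variance zero under each `μ x`, which is
ergodicity. Invariance of all `S f` makes them constant on orbit closures, which determines the
invariant measure there. -/

lemma integrable_continuousMap (μ : Measure Y) [IsFiniteMeasure μ] (f : C(Y, ℝ)) :
    Integrable (fun y => f y) μ :=
  f.continuous.integrable_of_hasCompactSupport (HasCompactSupport.of_compactSpace _)

/-- A positive linear functional on `C(Y, ℝ)` is represented by a finite measure. -/
theorem exists_measure_of_nonneg [T2Space Y] (Λ : C(Y, ℝ) →ₗ[ℝ] ℝ)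
    (hΛ : ∀ f : C(Y, ℝ), 0 ≤ f → 0 ≤ Λ f) :
    ∃ μ : Measure Y, IsFiniteMeasure μ ∧ ∀ f : C(Y, ℝ), ∫ y, f y ∂μ = Λ f := by
  let Λ₀ : CompactlySupportedContinuousMap Y ℝ →ₗ[ℝ] ℝ :=
    { toFun := fun f => Λ f.toContinuousMap
      map_add' := fun f g => Λ.map_add f.toContinuousMap g.toContinuousMap
      map_smul' := fun c f => Λ.map_smul c f.toContinuousMap }
  let Λ' : CompactlySupportedContinuousMap Y ℝ →ₚ[ℝ] ℝ :=
    PositiveLinearMap.mk₀ Λ₀ (fun f hf => hΛ _ hf)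
  refine ⟨RealRMK.rieszMeasure Λ', inferInstance, fun f => ?_⟩
  exact RealRMK.integral_rieszMeasure Λ'
    (CompactlySupportedContinuousMap.continuousMapEquiv f)

/-- A positive normalized linear functional on `C(Y, ℝ)` is represented by a probability measure. -/
theorem exists_probabilityMeasure_of_nonneg [T2Space Y] (Λ : C(Y, ℝ) →ₗ[ℝ] ℝ)
    (hΛ : ∀ f : C(Y, ℝ), 0 ≤ f → 0 ≤ Λ f) (h1 : Λ 1 = 1) :
    ∃ μ : ProbabilityMeasure Y, ∀ f : C(Y, ℝ), ∫ y, f y ∂(μ : Measure Y) = Λ f := by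
  obtain ⟨μ, hμ, h⟩ := exists_measure_of_nonneg Λ hΛ
  refine ⟨⟨μ, ?_⟩, h⟩
  have := h 1
  rw [h1] at this
  simp only [ContinuousMap.one_apply, integral_const, smul_eq_mul, mul_one] at this
  exact ⟨by rw [← ENNReal.toReal_eq_one_iff]; exact this⟩

theorem measure_eq_of_forall_integral_eq {Y : Type*} [TopologicalSpace Y] [HasOuterApproxClosed Y]
    [MeasurableSpace Y] [BorelSpace Y] {μ ν : Measure Y}
    [IsFiniteMeasure μ] [IsFiniteMeasure ν]
    (h : ∀ f : C(Y, ℝ), ∫ y, f y ∂μ = ∫ y, f y ∂ν) : μ = ν :=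
  ext_of_forall_integral_eq_of_IsFiniteMeasure fun f => h f.toContinuousMap

theorem tendsto_probabilityMeasure_iff {ι : Type*} {l : Filter ι}
    {μs : ι → ProbabilityMeasure Y} {μ : ProbabilityMeasure Y} :
    Tendsto μs l (𝓝 μ) ↔ ∀ f : C(Y, ℝ),
      Tendsto (fun i => ∫ y, f y ∂(μs i : Measure Y)) l (𝓝 (∫ y, f y ∂(μ : Measure Y))) := by
  rw [ProbabilityMeasure.tendsto_iff_forall_integral_tendsto]
  exact ⟨fun h f => h (BoundedContinuousFunction.mkOfCompact f), fun h f => h f.toContinuousMap⟩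

end Riesz

/-! ### Invariance and support of a measure, tested on continuous functions. -/

section Invariant

variable {G X : Type*} [Group G] [TopologicalSpace G] [MetricSpace X] [CompactSpace X]
  [MeasurableSpace X] [BorelSpace X] [MulAction G X] [ContinuousSMul G X]

theorem smulInvariantMeasure_iff_integral_koopman (μ : Measure X) [IsFiniteMeasure μ] :
    SMulInvariantMeasure G X μ ↔
      ∀ (g : G) (f : C(X, ℝ)), ∫ y, koopman g f y ∂μ = ∫ y, f y ∂μ := by
  have key : ∀ (g : G) (f : C(X, ℝ)),
      ∫ y, koopman g f y ∂μ = ∫ y, f y ∂(μ.map (fun y => g • y)) := fun g f =>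
    (integral_map (continuous_const_smul g).aemeasurable
      f.continuous.aestronglyMeasurable).symm
  constructor
  · intro h g f
    rw [key, (measurePreserving_smul g μ).map_eq]
  · intro h
    refine ⟨fun g s hs => ?_⟩
    have : μ.map (fun y => g • y) = μ :=
      measure_eq_of_forall_integral_eq fun f => by rw [← key, h]
    conv_rhs => rw [← this, Measure.map_apply (continuous_const_smul g).measurable hs]

/-- A finite measure that annihilates the continuous functions vanishing on the closed set `C` is
carried by `C`. -/
theorem measure_compl_eq_zero_of_forall_integral_eq_zero {μ : Measure X} [IsFiniteMeasure μ]
    {C : Set X} (hC : IsClosed C) (hne : C.Nonempty)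
    (h : ∀ f : C(X, ℝ), (∀ y ∈ C, f y = 0) → ∫ y, f y ∂μ = 0) : μ Cᶜ = 0 := by
  let f : C(X, ℝ) := ⟨fun y => Metric.infDist y C, Metric.continuous_infDist_pt C⟩
  have h0 := h f fun y hy => Metric.infDist_zero_of_mem hy
  have hnn : 0 ≤ fun y => f y := fun y => (Metric.infDist_nonneg : 0 ≤ f y)
  rw [integral_eq_zero_iff_of_nonneg hnn (integrable_continuousMap μ f)] at h0
  refine measure_mono_null (fun y hy => ?_) h0
  intro hy0
  exact hy ((hC.mem_iff_infDist_zero hne).2 hy0)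

end Invariant

/-! ### Kantorovich duality and continuity of the Wasserstein distance -/

section Wasserstein

variable {X : Type*} [MetricSpace X] [CompactSpace X] [MeasurableSpace X] [BorelSpace X]

lemma isProbabilityMeasure_of_map_fst {μ : Measure X} [IsProbabilityMeasure μ]
    {ι : Measure (X × X)} (h : ι.map Prod.fst = μ) : IsProbabilityMeasure ι := by
  refine ⟨?_⟩
  rw [← measure_univ (μ := μ), ← h, Measure.map_apply measurable_fst MeasurableSet.univ,
    Set.preimage_univ]

instance nonempty_joining (μ ν : Measure X) [IsProbabilityMeasure μ] [IsProbabilityMeasure ν] :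
    Nonempty {ι : Measure (X × X) // ι.map Prod.fst = μ ∧ ι.map Prod.snd = ν} :=
  ⟨⟨μ.prod ν, by simp [Measure.map_fst_prod], by simp [Measure.map_snd_prod]⟩⟩

lemma integral_dist_nonneg (ι : Measure (X × X)) : 0 ≤ ∫ p, dist p.1 p.2 ∂ι :=
  integral_nonneg fun _ => dist_nonneg

lemma wasserstein_nonneg (μ ν : Measure X) : 0 ≤ wasserstein μ ν :=
  Real.iInf_nonneg fun ι => integral_dist_nonneg ι.1

lemma wasserstein_le_of_joining {μ ν : Measure X} {ι : Measure (X × X)}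
    (h₁ : ι.map Prod.fst = μ) (h₂ : ι.map Prod.snd = ν) :
    wasserstein μ ν ≤ ∫ p, dist p.1 p.2 ∂ι :=
  ciInf_le (f := fun ι : {ι : Measure (X × X) // ι.map Prod.fst = μ ∧ ι.map Prod.snd = ν} =>
    ∫ p, dist p.1 p.2 ∂(ι : Measure (X × X)))
    ⟨0, by rintro _ ⟨ι, rfl⟩; exact integral_dist_nonneg ι.1⟩ ⟨ι, h₁, h₂⟩

lemma integrable_dist (ι : Measure (X × X)) [IsFiniteMeasure ι] :
    Integrable (fun p : X × X => dist p.1 p.2) ι :=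
  integrable_continuousMap ι ⟨fun p : X × X => dist p.1 p.2, continuous_dist⟩

lemma wasserstein_le_diam (μ ν : Measure X) [IsProbabilityMeasure μ] [IsProbabilityMeasure ν] :
    wasserstein μ ν ≤ Metric.diam (Set.univ : Set X) := by
  refine (wasserstein_le_of_joining (ι := μ.prod ν) (by simp [Measure.map_fst_prod])
    (by simp [Measure.map_snd_prod])).trans ?_
  calc ∫ p, dist p.1 p.2 ∂(μ.prod ν)
      ≤ ∫ _, Metric.diam (Set.univ : Set X) ∂(μ.prod ν) :=
        integral_mono (integrable_dist _) (integrable_const _) fun p =>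
          Metric.dist_le_diam_of_mem isCompact_univ.isBounded (Set.mem_univ _) (Set.mem_univ _)
    _ = _ := by simp

/-- The easy half of Kantorovich duality, for functions that are Lipschitz up to an error. -/
theorem integral_sub_le_wasserstein {μ ν : Measure X} [IsProbabilityMeasure μ]
    [IsProbabilityMeasure ν] {f : C(X, ℝ)} {ε C : ℝ} (hC : 0 < C)
    (hf : ∀ x y, f x - f y ≤ ε + C * dist x y) :
    ∫ x, f x ∂μ - ∫ x, f x ∂ν ≤ ε + C * wasserstein μ ν := by
  -- Solved for the distance, the claim is a lower bound to be checked on each joining.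
  suffices h : (∫ x, f x ∂μ - ∫ x, f x ∂ν - ε) / C ≤ wasserstein μ ν by
    rw [div_le_iff₀ hC] at h
    linarith
  refine le_ciInf fun ⟨ι, h₁, h₂⟩ => ?_
  have := isProbabilityMeasure_of_map_fst h₁
  rw [div_le_iff₀ hC]
  have e₁ : ∫ x, f x ∂μ = ∫ p : X × X, f p.1 ∂ι := by
    rw [← h₁, integral_map measurable_fst.aemeasurable f.continuous.aestronglyMeasurable]
  have e₂ : ∫ x, f x ∂ν = ∫ p : X × X, f p.2 ∂ι := by
    rw [← h₂, integral_map measurable_snd.aemeasurable f.continuous.aestronglyMeasurable]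
  have i₁ : Integrable (fun p : X × X => f p.1) ι :=
    integrable_continuousMap ι (f.comp ⟨Prod.fst, continuous_fst⟩)
  have i₂ : Integrable (fun p : X × X => f p.2) ι :=
    integrable_continuousMap ι (f.comp ⟨Prod.snd, continuous_snd⟩)
  have key : ∫ p : X × X, (f p.1 - f p.2) ∂ι ≤ ∫ p : X × X, (ε + C * dist p.1 p.2) ∂ι :=
    integral_mono (i₁.sub i₂) ((integrable_const _).add ((integrable_dist ι).const_mul C))
      fun p => hf p.1 p.2
  rw [integral_sub i₁ i₂, integral_add (integrable_const _) ((integrable_dist ι).const_mul C),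
    integral_const_mul] at key
  simp only [integral_const, probReal_univ, smul_eq_mul, one_mul] at key
  rw [e₁, e₂]
  linarith

/-- Integrating a nonnegative function `φ x + ψ y + t * dist x y` against the marginals. -/
lemma integral_add_integral_nonneg {μ ν : Measure X} [IsProbabilityMeasure μ]
    [IsProbabilityMeasure ν] {K : ℝ}
    (hK : ∀ f : C(X, ℝ), (∀ x y, f x - f y ≤ dist x y) → ∫ x, f x ∂μ - ∫ x, f x ∂ν ≤ K)
    (φ ψ : C(X, ℝ)) {t : ℝ} (ht : 0 ≤ t) (h : ∀ x y, 0 ≤ φ x + ψ y + t * dist x y) :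
    0 ≤ ∫ x, φ x ∂μ + ∫ x, ψ x ∂ν + K * t := by
  have hne : Nonempty X := nonempty_of_isProbabilityMeasure μ
  have bdd : ∀ x, BddBelow (Set.range fun y => ψ y + t * dist x y) := fun x =>
    ⟨-φ x, by rintro _ ⟨y, rfl⟩; have := h x y; dsimp only; linarith⟩
  have lip : ∀ x x', (⨅ y, (ψ y + t * dist x y)) ≤ (⨅ y, (ψ y + t * dist x' y))
      + t * dist x x' := by
    intro x x'
    rw [← sub_le_iff_le_add]
    refine le_ciInf fun y => ?_
    have h₁ := ciInf_le (bdd x) y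
    have h₂ := mul_le_mul_of_nonneg_left (dist_triangle x x' y) ht
    linarith
  have cont : Continuous fun x => ⨅ y, (ψ y + t * dist x y) :=
    (LipschitzWith.of_le_add_mul ⟨t, ht⟩ lip).continuous
  -- This infimal convolution is `t`-Lipschitz and lies between `-φ` and `ψ`, so `hK` applies to it
  -- after rescaling; for `t = 0` it is constant.
  let f : C(X, ℝ) := ⟨fun x => ⨅ y, (ψ y + t * dist x y), cont⟩
  have hφ : ∀ x, -φ x ≤ f x := fun x => le_ciInf fun y => by have := h x y; linarith
  have hψ : ∀ x, f x ≤ ψ x := fun x => (ciInf_le (bdd x) x).trans (by simp)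
  have i₁ : -∫ x, φ x ∂μ ≤ ∫ x, f x ∂μ := by
    rw [← integral_neg]
    exact integral_mono (integrable_continuousMap μ φ).neg (integrable_continuousMap μ f) hφ
  have i₂ : ∫ x, f x ∂ν ≤ ∫ x, ψ x ∂ν :=
    integral_mono (integrable_continuousMap ν f) (integrable_continuousMap ν ψ) hψ
  have i₃ : ∫ x, f x ∂μ - ∫ x, f x ∂ν ≤ K * t := by
    rcases ht.eq_or_lt with rfl | ht
    · obtain ⟨x₀⟩ := hne
      have hc : ∀ x, f x = f x₀ := fun x => le_antisymm
        ((lip x x₀).trans (by rw [zero_mul, add_zero]; exact le_rfl))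
        ((lip x₀ x).trans (by rw [zero_mul, add_zero]; exact le_rfl))
      simp [hc]
    · have h₁ := hK (t⁻¹ • f) fun x y => by
        have : f x ≤ f y + t * dist x y := lip x y
        simp only [ContinuousMap.smul_apply, smul_eq_mul]
        rw [← mul_sub, inv_mul_le_iff₀ ht]
        linarith
      simp only [ContinuousMap.smul_apply, smul_eq_mul, integral_const_mul] at h₁
      rw [← mul_sub, inv_mul_le_iff₀ ht] at h₁
      linarith
  linarith

/-- The hard half of Kantorovich duality. -/
theorem wasserstein_le_of_forall_integral_sub_le {μ ν : Measure X} [IsProbabilityMeasure μ]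
    [IsProbabilityMeasure ν] {K : ℝ}
    (hK : ∀ f : C(X, ℝ), (∀ x y, f x - f y ≤ dist x y) → ∫ x, f x ∂μ - ∫ x, f x ∂ν ≤ K) :
    wasserstein μ ν ≤ K := by
  -- The cone is the region above a sublinear functional: `u` is dominated by `φ x + ψ y + t * dist
  -- x y` at cost `∫ φ ∂μ + ∫ ψ ∂ν + K * t`. A linear functional below it is the desired joining:
  -- separate choices of `φ`, `ψ` and `t` give the marginals and the bound `K`.
  let s : PointedCone ℝ (C(X × X, ℝ) × ℝ) :=
    { carrier := {p | ∃ (φ ψ : C(X, ℝ)) (t : ℝ), 0 ≤ t ∧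
        (∀ x y, p.1 (x, y) ≤ φ x + ψ y + t * dist x y) ∧
        ∫ x, φ x ∂μ + ∫ x, ψ x ∂ν + K * t ≤ p.2}
      zero_mem' := ⟨0, 0, 0, le_rfl, by simp, by simp⟩
      add_mem' := by
        rintro ⟨u, r⟩ ⟨u', r'⟩ ⟨φ, ψ, t, ht, h, hr⟩ ⟨φ', ψ', t', ht', h', hr'⟩
        refine ⟨φ + φ', ψ + ψ', t + t', add_nonneg ht ht', fun x y => ?_, ?_⟩
        · have h₁ := h x y
          have h₂ := h' x y
          simp only [Prod.mk_add_mk, ContinuousMap.add_apply] at h₁ h₂ ⊢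
          linarith
        · simp only [Prod.mk_add_mk, ContinuousMap.add_apply] at hr hr' ⊢
          rw [integral_add (integrable_continuousMap μ φ) (integrable_continuousMap μ φ'),
            integral_add (integrable_continuousMap ν ψ) (integrable_continuousMap ν ψ')]
          linarith
      smul_mem' := by
        rintro ⟨c, hc⟩ ⟨u, r⟩ ⟨φ, ψ, t, ht, h, hr⟩
        refine ⟨c • φ, c • ψ, c * t, mul_nonneg hc ht, fun x y => ?_, ?_⟩
        · have h₁ := mul_le_mul_of_nonneg_left (h x y) hc
          simp only [ContinuousMap.smul_apply, smul_eq_mul] at h₁ ⊢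
          change c * u (x, y) ≤ _
          linarith
        · have h₁ := mul_le_mul_of_nonneg_left hr hc
          simp only [ContinuousMap.smul_apply, smul_eq_mul, integral_const_mul] at h₁ ⊢
          change _ ≤ c * r
          linarith }
  -- The functional `(0, r) ↦ r` is nonnegative on the cone by `integral_add_integral_nonneg`; the
  -- constant majorant `‖u‖` shows that translates of every vector reach the cone.
  obtain ⟨g, hg, hgs⟩ := riesz_extension s
    ((LinearMap.snd ℝ C(X × X, ℝ) ℝ).toPMap (Submodule.prod ⊥ ⊤))
    (by
      rintro ⟨⟨u, r⟩, hu⟩ ⟨φ, ψ, t, ht, h, hr⟩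
      have hu0 : u = 0 := by simpa using hu.1
      subst hu0
      exact (integral_add_integral_nonneg hK φ ψ ht (by simpa using h)).trans hr)
    (by
      rintro ⟨u, r⟩
      refine ⟨⟨(0, ‖u‖ - r), ⟨by simp, by simp⟩⟩, ContinuousMap.const X ‖u‖, 0, 0, le_rfl,
        fun x y => ?_, by simp⟩
      simpa using (le_abs_self _).trans (u.norm_coe_le_norm (x, y)))
  have hg1 : ∀ r : ℝ, g (0, r) = r := fun r => hg ⟨(0, r), ⟨by simp, by simp⟩⟩
  let Λ : C(X × X, ℝ) →ₗ[ℝ] ℝ := -(g.comp (LinearMap.inl ℝ _ _))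
  have hΛs : ∀ u r, (u, r) ∈ s → Λ u ≤ r := by
    intro u r hur
    have h₁ := hgs _ hur
    have h₂ : ((u, r) : C(X × X, ℝ) × ℝ) = (u, 0) + (0, r) := by simp
    rw [h₂, map_add, hg1] at h₁
    change -(g (u, 0)) ≤ r
    linarith
  have hΛ : ∀ u : C(X × X, ℝ), 0 ≤ u → 0 ≤ Λ u := by
    intro u hu
    have := hΛs (-u) 0 ⟨0, 0, 0, le_rfl, fun x y => by simpa using hu (x, y), by simp⟩
    rw [map_neg] at this
    linarith
  obtain ⟨ι, hι, hint⟩ := exists_measure_of_nonneg Λ hΛ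
  have m₁ : ι.map Prod.fst = μ := measure_eq_of_forall_integral_eq fun f => by
    have key : ∀ f : C(X, ℝ), ∫ p : X × X, f p.1 ∂ι ≤ ∫ x, f x ∂μ := fun f => by
      refine (hint (f.comp ⟨Prod.fst, continuous_fst⟩)).trans_le ?_
      exact hΛs _ _ ⟨f, 0, 0, le_rfl, fun x y => by simp, by simp⟩
    rw [integral_map measurable_fst.aemeasurable f.continuous.aestronglyMeasurable]
    -- Testing `-f` as well turns the one-sided bound into an equality.
    have := key (-f)
    simp only [ContinuousMap.neg_apply, integral_neg] at this
    exact le_antisymm (key f) (by linarith)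
  have m₂ : ι.map Prod.snd = ν := measure_eq_of_forall_integral_eq fun f => by
    have key : ∀ f : C(X, ℝ), ∫ p : X × X, f p.2 ∂ι ≤ ∫ x, f x ∂ν := fun f => by
      refine (hint (f.comp ⟨Prod.snd, continuous_snd⟩)).trans_le ?_
      exact hΛs _ _ ⟨0, f, 0, le_rfl, fun x y => by simp, by simp⟩
    rw [integral_map measurable_snd.aemeasurable f.continuous.aestronglyMeasurable]
    have := key (-f)
    simp only [ContinuousMap.neg_apply, integral_neg] at this
    exact le_antisymm (key f) (by linarith)
  refine (wasserstein_le_of_joining m₁ m₂).trans ?_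
  refine (hint ⟨fun p : X × X => dist p.1 p.2, continuous_dist⟩).trans_le ?_
  exact hΛs _ _ ⟨0, 0, 1, zero_le_one, fun x y => by simp, by simp⟩

lemma integral_sub_le_wasserstein_of_lipschitz {μ ν : Measure X} [IsProbabilityMeasure μ]
    [IsProbabilityMeasure ν] {f : C(X, ℝ)} (hf : ∀ x y, f x - f y ≤ dist x y) :
    ∫ x, f x ∂μ - ∫ x, f x ∂ν ≤ wasserstein μ ν := by
  simpa using integral_sub_le_wasserstein (μ := μ) (ν := ν) (ε := 0) one_pos
    (f := f) (by simpa using hf)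

lemma wasserstein_le_comm (μ ν : Measure X) [IsProbabilityMeasure μ] [IsProbabilityMeasure ν] :
    wasserstein μ ν ≤ wasserstein ν μ :=
  wasserstein_le_of_forall_integral_sub_le fun f hf => by
    have := integral_sub_le_wasserstein_of_lipschitz (μ := ν) (ν := μ) (f := -f)
      (fun x y => by have := hf y x; rw [dist_comm]; simp only [ContinuousMap.neg_apply]; linarith)
    simp only [ContinuousMap.neg_apply, integral_neg] at this
    linarith

lemma wasserstein_comm (μ ν : Measure X) [IsProbabilityMeasure μ] [IsProbabilityMeasure ν] :
    wasserstein μ ν = wasserstein ν μ :=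
  le_antisymm (wasserstein_le_comm μ ν) (wasserstein_le_comm ν μ)

lemma wasserstein_triangle (μ ν ρ : Measure X) [IsProbabilityMeasure μ] [IsProbabilityMeasure ν]
    [IsProbabilityMeasure ρ] : wasserstein μ ρ ≤ wasserstein μ ν + wasserstein ν ρ :=
  wasserstein_le_of_forall_integral_sub_le fun f hf => by
    have h₁ := integral_sub_le_wasserstein_of_lipschitz (μ := μ) (ν := ν) hf
    have h₂ := integral_sub_le_wasserstein_of_lipschitz (μ := ν) (ν := ρ) hf
    linarith

/-- The normalized Lipschitz functions form a totally bounded set. -/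
lemma totallyBounded_lipschitz (x₀ : X) :
    TotallyBounded {f : X →ᵇ ℝ | (∀ x y, f x - f y ≤ dist x y) ∧ f x₀ = 0} := by
  refine TotallyBounded.subset subset_closure (IsCompact.totallyBounded ?_)
  refine BoundedContinuousFunction.arzela_ascoli
    (Metric.closedBall 0 (Metric.diam (Set.univ : Set X))) (isCompact_closedBall _ _) _ ?_ ?_
  · rintro f x ⟨hf, h0⟩
    have hd : dist x x₀ ≤ Metric.diam (Set.univ : Set X) :=
      Metric.dist_le_diam_of_mem isCompact_univ.isBounded (Set.mem_univ _) (Set.mem_univ _)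
    have h₁ := hf x x₀
    have h₂ := hf x₀ x
    rw [dist_comm] at h₂
    rw [mem_closedBall_zero_iff, Real.norm_eq_abs, abs_le]
    constructor <;> linarith
  · refine (LipschitzWith.uniformEquicontinuous _ 1 fun f => ?_).equicontinuous
    refine LipschitzWith.of_le_add fun x y => ?_
    have := f.2.1 x y
    linarith

/-- The Wasserstein distance to a weak limit tends to zero. -/
theorem tendsto_wasserstein_zero {ι : Type*} {l : Filter ι} {μs : ι → ProbabilityMeasure X}
    {μ : ProbabilityMeasure X} (h : Tendsto μs l (𝓝 μ)) :
    Tendsto (fun i => wasserstein (μs i : Measure X) (μ : Measure X)) l (𝓝 0) := by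
  obtain ⟨x₀⟩ : Nonempty X := nonempty_of_isProbabilityMeasure (μ : Measure X)
  rw [tendsto_probabilityMeasure_iff] at h
  rw [Metric.tendsto_nhds]
  intro ε hε
  -- By duality, convergence must be uniform over Lipschitz functions; total boundedness leaves
  -- finitely many. Normalizing at `x₀` does not affect differences of integrals.
  obtain ⟨T, hT, hcov⟩ := Metric.totallyBounded_iff.1 (totallyBounded_lipschitz x₀) (ε / 4)
    (by positivity)
  have hev : ∀ᶠ i in l, ∀ t ∈ T,
      |∫ x, t x ∂(μs i : Measure X) - ∫ x, t x ∂(μ : Measure X)| < ε / 4 :=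
    (eventually_all_finite hT).2 fun t _ => by
      have := (Metric.tendsto_nhds.1 (h t.toContinuousMap)) (ε / 4) (by positivity)
      simpa [Real.dist_eq] using this
  filter_upwards [hev] with i hi
  rw [Real.dist_eq, sub_zero, abs_of_nonneg (wasserstein_nonneg _ _)]
  -- Two approximation errors and one error for the test function.
  refine lt_of_le_of_lt (b := 3 * (ε / 4)) ?_ (by linarith)
  refine wasserstein_le_of_forall_integral_sub_le fun f hf => ?_
  let f₀ : X →ᵇ ℝ := BoundedContinuousFunction.mkOfCompact (f - ContinuousMap.const X (f x₀))
  have hf₀ : ∀ x, f₀ x = f x - f x₀ := fun x => rfl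
  obtain ⟨t, ht, hft⟩ := Set.mem_iUnion₂.1 (hcov (show f₀ ∈ _ from
    ⟨fun x y => by have := hf x y; rw [hf₀, hf₀]; linarith, by rw [hf₀, sub_self]⟩))
  have hclose : ∀ x, |f x - f x₀ - t x| ≤ ε / 4 := fun x => by
    have h₁ := BoundedContinuousFunction.dist_coe_le_dist (f := f₀) (g := t) x
    have h₂ := Metric.mem_ball.1 hft
    rw [Real.dist_eq, hf₀] at h₁
    linarith
  have happrox : ∀ ν : ProbabilityMeasure X,
      |∫ x, f x ∂(ν : Measure X) - f x₀ - ∫ x, t x ∂(ν : Measure X)| ≤ ε / 4 := fun ν => by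
    have i₁ := integrable_continuousMap (ν : Measure X) f
    have i₂ : Integrable (fun x => t x) (ν : Measure X) :=
      integrable_continuousMap (ν : Measure X) t.toContinuousMap
    have i₃ : Integrable (fun x => f x - f x₀) (ν : Measure X) := i₁.sub (integrable_const _)
    have e : ∫ x, f x ∂(ν : Measure X) - f x₀ - ∫ x, t x ∂(ν : Measure X)
        = ∫ x, (f x - f x₀ - t x) ∂(ν : Measure X) := by
      rw [integral_sub i₃ i₂, integral_sub i₁ (integrable_const _)]
      simp
    rw [e]
    have := norm_integral_le_of_norm_le_const (μ := (ν : Measure X)) (C := ε / 4)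
      (f := fun x => f x - f x₀ - t x) (Eventually.of_forall hclose)
    simpa using this
  have h₁ := abs_le.1 (happrox (μs i))
  have h₂ := abs_le.1 (happrox μ)
  have h₃ := abs_lt.1 (hi t ht)
  linarith [h₁.1, h₁.2, h₂.1, h₂.2, h₃.1, h₃.2]

/-- The Wasserstein distance is continuous for weak convergence. -/
theorem tendsto_wasserstein {ι : Type*} {l : Filter ι} {μs νs : ι → ProbabilityMeasure X}
    {μ ν : ProbabilityMeasure X} (hμ : Tendsto μs l (𝓝 μ)) (hν : Tendsto νs l (𝓝 ν)) :
    Tendsto (fun i => wasserstein (μs i : Measure X) (νs i : Measure X)) l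
      (𝓝 (wasserstein (μ : Measure X) (ν : Measure X))) := by
  have h₁ := tendsto_wasserstein_zero hμ
  have h₂ := tendsto_wasserstein_zero hν
  rw [tendsto_iff_dist_tendsto_zero]
  refine squeeze_zero (fun _ => dist_nonneg) (fun i => ?_) (by simpa using h₁.add h₂)
  rw [Real.dist_eq, abs_le]
  have t₁ := wasserstein_triangle (μs i : Measure X) (μ : Measure X) (νs i : Measure X)
  have t₂ := wasserstein_triangle (μ : Measure X) (ν : Measure X) (νs i : Measure X)
  have t₃ := wasserstein_triangle (μ : Measure X) (μs i : Measure X) (ν : Measure X)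
  have t₄ := wasserstein_triangle (μs i : Measure X) (νs i : Measure X) (ν : Measure X)
  have c₁ := wasserstein_comm (ν : Measure X) (νs i : Measure X)
  have c₂ := wasserstein_comm (μ : Measure X) (μs i : Measure X)
  constructor <;> linarith

end Wasserstein

/-! ### Averages along sets of finite positive measure -/

/-- The sets `F n` are measurable and have finite positive measure. -/
structure IsAveraging {G : Type*} [MeasurableSpace G] (θ : Measure G) (F : ℕ → Set G) : Prop where
  measurableSet : ∀ n, MeasurableSet (F n)
  ne_zero : ∀ n, θ (F n) ≠ 0
  ne_top : ∀ n, θ (F n) ≠ ⊤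

section Averages

variable {G X : Type*} [Group G] [TopologicalSpace G] [MeasurableSpace G] [BorelSpace G]
  [MetricSpace X] [CompactSpace X] [MeasurableSpace X] [BorelSpace X]
  [MulAction G X] [ContinuousSMul G X] {θ : Measure G} {F : ℕ → Set G}

lemma continuous_smul_const (x : X) : Continuous fun g : G => g • x :=
  continuous_id.smul continuous_const

lemma IsAveraging.isFiniteMeasure (hF : IsAveraging θ F) (n : ℕ) :
    IsFiniteMeasure (θ.restrict (F n)) :=
  ⟨by rw [Measure.restrict_apply_univ]; exact (hF.ne_top n).lt_top⟩

lemma IsAveraging.real_pos (hF : IsAveraging θ F) (n : ℕ) : 0 < θ.real (F n) :=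
  ENNReal.toReal_pos (hF.ne_zero n) (hF.ne_top n)

lemma IsAveraging.isProbabilityMeasure_orbitMeasure (hF : IsAveraging θ F) (n : ℕ) (x : X) :
    IsProbabilityMeasure (orbitMeasure θ F n x) := by
  have : IsProbabilityMeasure ((θ (F n))⁻¹ • θ.restrict (F n)) :=
    ⟨by simp [ENNReal.inv_mul_cancel (hF.ne_zero n) (hF.ne_top n)]⟩
  exact Measure.isProbabilityMeasure_map (continuous_smul_const x).aemeasurable

/-- The measure `orbitMeasure θ F n x` as a probability measure. -/
noncomputable def orbitProbability (hF : IsAveraging θ F) (n : ℕ) (x : X) : ProbabilityMeasure X :=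
  ⟨orbitMeasure θ F n x, hF.isProbabilityMeasure_orbitMeasure n x⟩

lemma coe_orbitProbability (hF : IsAveraging θ F) (n : ℕ) (x : X) :
    (orbitProbability hF n x : Measure X) = orbitMeasure θ F n x := rfl

lemma integral_orbitProbability (hF : IsAveraging θ F) (n : ℕ) (f : C(X, ℝ)) (x : X) :
    ∫ y, f y ∂(orbitProbability hF n x : Measure X) = folnerAverage θ F n f x := by
  rw [coe_orbitProbability, orbitMeasure, integral_map (continuous_smul_const x).aemeasurable
    f.continuous.aestronglyMeasurable, integral_smul_measure, folnerAverage]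
  simp [Measure.real]

lemma abs_integral_le_norm (μ : ProbabilityMeasure X) (f : C(X, ℝ)) :
    |∫ y, f y ∂(μ : Measure X)| ≤ ‖f‖ := by
  have := norm_integral_le_of_norm_le_const (μ := (μ : Measure X)) (C := ‖f‖)
    (f := fun x => f x) (Eventually.of_forall f.norm_coe_le_norm)
  simpa using this

lemma abs_folnerAverage_le (hF : IsAveraging θ F) (n : ℕ) (f : C(X, ℝ)) (x : X) :
    |folnerAverage θ F n f x| ≤ ‖f‖ := by
  rw [← integral_orbitProbability hF]
  exact abs_integral_le_norm _ f

lemma folnerAverage_add (hF : IsAveraging θ F) (n : ℕ) (f h : C(X, ℝ)) (x : X) :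
    folnerAverage θ F n (f + h) x = folnerAverage θ F n f x + folnerAverage θ F n h x := by
  simp only [← integral_orbitProbability hF, ContinuousMap.add_apply]
  exact integral_add (integrable_continuousMap _ f) (integrable_continuousMap _ h)

lemma folnerAverage_smul (n : ℕ) (c : ℝ) (f : C(X, ℝ)) (x : X) :
    folnerAverage θ F n (c • f) x = c * folnerAverage θ F n f x := by
  simp only [folnerAverage, ContinuousMap.smul_apply, smul_eq_mul, integral_const_mul]
  ring

lemma folnerAverage_sub (hF : IsAveraging θ F) (n : ℕ) (f h : C(X, ℝ)) (x : X) :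
    folnerAverage θ F n (f - h) x = folnerAverage θ F n f x - folnerAverage θ F n h x := by
  simp only [← integral_orbitProbability hF, ContinuousMap.sub_apply]
  exact integral_sub (integrable_continuousMap _ f) (integrable_continuousMap _ h)

/-! ### From weak mean equicontinuity to convergence along a subsequence -/

/-- A continuous function on a compact metric space is Lipschitz up to an arbitrary error. -/
lemma exists_sub_le_add_mul_dist (f : C(X, ℝ)) {ε : ℝ} (hε : 0 < ε) :
    ∃ C > 0, ∀ x y, f x - f y ≤ ε + C * dist x y := by
  obtain ⟨δ, hδ, h⟩ := Metric.uniformContinuous_iff.1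
    (CompactSpace.uniformContinuous_of_continuous f.continuous) ε hε
  refine ⟨(2 * ‖f‖ + 1) / δ, by positivity, fun x y => ?_⟩
  rcases lt_or_ge (dist x y) δ with hd | hd
  · have h₁ := (le_abs_self _).trans_lt (Real.dist_eq (f x) (f y) ▸ h hd)
    have : 0 ≤ (2 * ‖f‖ + 1) / δ * dist x y := by positivity
    linarith
  · have h₁ := abs_le.1 (f.norm_coe_le_norm x)
    have h₂ := abs_le.1 (f.norm_coe_le_norm y)
    have h₃ : 2 * ‖f‖ + 1 ≤ (2 * ‖f‖ + 1) / δ * dist x y := by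
      rw [div_mul_eq_mul_div, le_div_iff₀ hδ]
      exact mul_le_mul_of_nonneg_left hd (by positivity)
    linarith [h₁.1, h₁.2, h₂.1, h₂.2]

lemma wasserstein_self (μ : Measure X) [IsProbabilityMeasure μ] : wasserstein μ μ = 0 :=
  le_antisymm (wasserstein_le_of_forall_integral_sub_le fun f _ => by simp)
    (wasserstein_nonneg _ _)

lemma folnerPseudometric_self (hF : IsAveraging θ F) (x : X) : folnerPseudometric θ F x x = 0 := by
  have : ∀ n, wasserstein (orbitMeasure θ F n x) (orbitMeasure θ F n x) = 0 := fun n =>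
    have := hF.isProbabilityMeasure_orbitMeasure n x
    wasserstein_self _
  simp [folnerPseudometric, this]

lemma IsWeaklyMeanEquicontinuous.continuous_right (h : IsWeaklyMeanEquicontinuous X θ F) (x : X) :
    Continuous fun y : X => folnerPseudometric θ F x y := by
  unfold IsWeaklyMeanEquicontinuous at h
  have hx := Continuous.prodMk_right (Y := X) x
  have := Continuous.comp h hx
  exact this

/-- The pseudometric vanishes on the diagonal, so by continuity it is small near `x`. The
neighbourhood is independent of `n`, but the threshold for `n` may depend on `y`; this still
suffices for passing to limits. -/
lemma abs_folnerAverage_sub_lt_of_isWeaklyMeanEquicontinuous (hF : IsAveraging θ F)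
    (h : IsWeaklyMeanEquicontinuous X θ F) (f : C(X, ℝ)) (x : X) {ε : ℝ} (hε : 0 < ε) :
    ∀ᶠ y in 𝓝 x, ∀ᶠ n in atTop, |folnerAverage θ F n f x - folnerAverage θ F n f y| < ε := by
  obtain ⟨C, hC, hf⟩ := exists_sub_le_add_mul_dist f (half_pos hε)
  have hev : ∀ᶠ y in 𝓝 x, folnerPseudometric θ F x y < ε / 2 / C :=
    (h.continuous_right x).continuousAt.eventually_lt_const (by
      beta_reduce; rw [folnerPseudometric_self hF]; positivity)
  refine hev.mono fun y hy => ?_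
  have hbdd : IsBoundedUnder (· ≤ ·) atTop
      fun n => wasserstein (orbitMeasure θ F n x) (orbitMeasure θ F n y) :=
    isBoundedUnder_of ⟨Metric.diam (Set.univ : Set X), fun n =>
      wasserstein_le_diam (orbitProbability hF n x : Measure X)
        (orbitProbability hF n y : Measure X)⟩
  refine (eventually_lt_of_limsup_lt hy hbdd).mono fun n hn => ?_
  have hW : C * wasserstein (orbitMeasure θ F n x) (orbitMeasure θ F n y) < ε / 2 := by
    rw [lt_div_iff₀ hC] at hn
    linarith
  have h₁ := integral_sub_le_wasserstein (μ := (orbitProbability hF n x : Measure X))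
    (ν := (orbitProbability hF n y : Measure X)) hC hf
  have h₂ := integral_sub_le_wasserstein (μ := (orbitProbability hF n y : Measure X))
    (ν := (orbitProbability hF n x : Measure X)) hC hf
  rw [wasserstein_comm (orbitProbability hF n y : Measure X)] at h₂
  rw [integral_orbitProbability, integral_orbitProbability, coe_orbitProbability,
    coe_orbitProbability] at h₁ h₂
  rw [abs_lt]
  constructor <;> linarith

/-- Along a subsequence, the averages converge for countably many functions and points. -/
lemma exists_subseq_tendsto_of_countable (hF : IsAveraging θ F) {A : Set C(X, ℝ)} {Q : Set X}
    (hA : A.Countable) (hQ : Q.Countable) :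
    ∃ φ : ℕ → ℕ, StrictMono φ ∧ ∀ f ∈ A, ∀ x ∈ Q,
      ∃ l, Tendsto (fun n => folnerAverage θ F (φ n) f x) atTop (𝓝 l) := by
  have := hA.to_subtype
  have := hQ.to_subtype
  have hcomp : IsCompact (Set.univ.pi fun p : A × Q =>
      Set.Icc (-‖(p.1 : C(X, ℝ))‖) ‖(p.1 : C(X, ℝ))‖) :=
    isCompact_univ_pi fun _ => isCompact_Icc
  obtain ⟨a, -, φ, hφ, hlim⟩ := hcomp.tendsto_subseq
    (x := fun n (p : A × Q) => folnerAverage θ F n (p.1 : C(X, ℝ)) (p.2 : X))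
    (fun n p _ => abs_le.1 (abs_folnerAverage_le hF n _ _))
  exact ⟨φ, hφ, fun f hf x hx => ⟨_, tendsto_pi_nhds.1 hlim (⟨f, hf⟩, ⟨x, hx⟩)⟩⟩

theorem exists_subseq_averagesTendsto (hF : IsAveraging θ F)
    (h : IsWeaklyMeanEquicontinuous X θ F) :
    ∃ (φ : ℕ → ℕ) (S : C(X, ℝ) →L[ℝ] C(X, ℝ)),
      StrictMono φ ∧ AveragesTendsto θ (F ∘ φ) S := by
  obtain ⟨A, hA, hAd⟩ := TopologicalSpace.exists_countable_dense C(X, ℝ)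
  obtain ⟨Q, hQ, hQd⟩ := TopologicalSpace.exists_countable_dense X
  obtain ⟨φ, hφ, hlim⟩ := exists_subseq_tendsto_of_countable (X := X) hF hA hQ
  have hcauchy : ∀ (f : C(X, ℝ)) (x : X),
      CauchySeq fun n => folnerAverage θ F (φ n) f x := by
    intro f x
    refine Metric.cauchySeq_iff.2 fun ε hε => ?_
    obtain ⟨f', hff', hf'A⟩ := Metric.dense_iff.1 hAd f (ε / 8) (by positivity)
    obtain ⟨y, hyQ, hy⟩ := hQd.inter_nhds_nonempty
      (abs_folnerAverage_sub_lt_of_isWeaklyMeanEquicontinuous hF h f' x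
        (ε := ε / 8) (by positivity))
    obtain ⟨l, hl⟩ := hlim f' hf'A y hyQ
    -- Three errors of `ε / 8`: replacing `f` by `f'`, replacing `x` by `y`, and convergence at
    -- `(f', y)`.
    have hev : ∀ᶠ n in atTop, |folnerAverage θ F (φ n) f x - l| < ε / 2 := by
      filter_upwards [hφ.tendsto_atTop.eventually hy,
        Metric.tendsto_nhds.1 hl (ε / 8) (by positivity)] with n h₁ h₂
      have h₃ := abs_folnerAverage_le hF (φ n) (f - f') x
      rw [folnerAverage_sub hF] at h₃
      have h₄ : ‖f - f'‖ < ε / 8 := by rw [← dist_eq_norm, dist_comm]; exact hff'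
      rw [Real.dist_eq] at h₂
      have h₅ := abs_le.1 h₃
      rw [abs_lt] at h₁ h₂ ⊢
      constructor <;> linarith [h₅.1, h₅.2, h₁.1, h₁.2, h₂.1, h₂.2]
    obtain ⟨N, hN⟩ := eventually_atTop.1 hev
    refine ⟨N, fun m hm n hn => ?_⟩
    have h₁ := abs_lt.1 (hN m hm)
    have h₂ := abs_lt.1 (hN n hn)
    rw [Real.dist_eq, abs_lt]
    constructor <;> linarith [h₁.1, h₁.2, h₂.1, h₂.2]
  choose L hL using fun f x => cauchySeq_tendsto_of_complete (hcauchy f x)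
  have hcont : ∀ f, Continuous (L f) := fun f => continuous_iff_continuousAt.2 fun x => by
    refine Metric.tendsto_nhds.2 fun ε hε => ?_
    filter_upwards [abs_folnerAverage_sub_lt_of_isWeaklyMeanEquicontinuous hF h f x
      (half_pos hε)] with y hy
    rw [dist_comm, Real.dist_eq]
    refine lt_of_le_of_lt (le_of_tendsto ((hL f x).sub (hL f y)).abs ?_) (half_lt_self hε)
    exact (hφ.tendsto_atTop.eventually hy).mono fun _ hn => hn.le
  let S₀ : C(X, ℝ) →ₗ[ℝ] C(X, ℝ) :=
    { toFun := fun f => ⟨L f, hcont f⟩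
      map_add' := fun f f' => ContinuousMap.ext fun x =>
        tendsto_nhds_unique (hL (f + f') x)
          (((hL f x).add (hL f' x)).congr fun n => (folnerAverage_add hF _ f f' x).symm)
      map_smul' := fun c f => ContinuousMap.ext fun x =>
        tendsto_nhds_unique (hL (c • f) x)
          (((hL f x).const_mul c).congr fun n => (folnerAverage_smul _ c f x).symm) }
  refine ⟨φ, S₀.mkContinuous 1 fun f => ?_, hφ, fun f x => hL f x⟩
  rw [one_mul]
  exact (ContinuousMap.norm_le _ (norm_nonneg f)).2 fun x =>
    le_of_tendsto (hL f x).abs (Eventually.of_forall fun n => abs_folnerAverage_le hF _ _ _)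

/-! ### Consequences of pointwise convergence to a continuous limit -/

lemma AveragesTendsto.nonneg {S : C(X, ℝ) →L[ℝ] C(X, ℝ)} (hS : AveragesTendsto θ F S)
    {f : C(X, ℝ)} (hf : 0 ≤ f) : 0 ≤ S f := fun x =>
  ge_of_tendsto' (hS f x) fun _ => mul_nonneg (inv_nonneg.2 measureReal_nonneg)
    (integral_nonneg fun g => hf (g • x))

lemma AveragesTendsto.map_one {S : C(X, ℝ) →L[ℝ] C(X, ℝ)} (hF : IsAveraging θ F)
    (hS : AveragesTendsto θ F S) : S 1 = 1 := by
  ext x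
  refine tendsto_nhds_unique (hS 1 x) (tendsto_const_nhds.congr fun n => ?_)
  simp [← integral_orbitProbability hF]

lemma AveragesTendsto.norm_le_one {S : C(X, ℝ) →L[ℝ] C(X, ℝ)} (hF : IsAveraging θ F)
    (hS : AveragesTendsto θ F S) : ‖S‖ ≤ 1 :=
  S.opNorm_le_bound zero_le_one fun f => by
    rw [one_mul]
    exact (ContinuousMap.norm_le _ (norm_nonneg f)).2 fun x =>
      le_of_tendsto (hS f x).abs (Eventually.of_forall fun n => abs_folnerAverage_le hF _ _ _)

/-- The limit operator is given by a weak*-continuous family of probability measures. -/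
lemma AveragesTendsto.exists_measure {S : C(X, ℝ) →L[ℝ] C(X, ℝ)} (hF : IsAveraging θ F)
    (hS : AveragesTendsto θ F S) :
    ∃ μ : X → ProbabilityMeasure X, Continuous μ ∧
      ∀ (f : C(X, ℝ)) (x : X), S f x = ∫ y, f y ∂(μ x : Measure X) := by
  choose μ hμ using fun x => exists_probabilityMeasure_of_nonneg
    ((ContinuousMap.evalCLM ℝ x).toLinearMap.comp S.toLinearMap)
    (fun f hf => hS.nonneg hf x) (by simp [hS.map_one hF])
  have hμ' : ∀ (f : C(X, ℝ)) (x : X), S f x = ∫ y, f y ∂(μ x : Measure X) :=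
    fun f x => (hμ x f).symm
  refine ⟨μ, continuous_iff_continuousAt.2 fun x => ?_, hμ'⟩
  refine tendsto_probabilityMeasure_iff.2 fun f => ?_
  simp only [← hμ']
  exact (S f).continuous.continuousAt

/-- The orbit measures converge weakly to `μ x`, so the limsup is a true limit, namely the distance
of `μ x` and `μ y`. -/
lemma AveragesTendsto.isWeaklyMeanEquicontinuous {S : C(X, ℝ) →L[ℝ] C(X, ℝ)}
    (hF : IsAveraging θ F) (hS : AveragesTendsto θ F S) {μ : X → ProbabilityMeasure X}
    (hμc : Continuous μ) (hμ : ∀ (f : C(X, ℝ)) (x : X), S f x = ∫ y, f y ∂(μ x : Measure X)) :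
    IsWeaklyMeanEquicontinuous X θ F := by
  have hlim : ∀ x, Tendsto (fun n => orbitProbability hF n x) atTop (𝓝 (μ x)) := fun x =>
    tendsto_probabilityMeasure_iff.2 fun f => by
      simpa only [integral_orbitProbability, hμ] using hS f x
  have heq : ∀ p : X × X, folnerPseudometric θ F p.1 p.2
      = wasserstein (μ p.1 : Measure X) (μ p.2 : Measure X) := fun p =>
    (tendsto_wasserstein (hlim p.1) (hlim p.2)).limsup_eq
  unfold IsWeaklyMeanEquicontinuous
  simp only [heq]
  exact continuous_iff_continuousAt.2 fun p =>
    tendsto_wasserstein (hμc.comp continuous_fst).continuousAt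
      (hμc.comp continuous_snd).continuousAt

/-- Invariant measures do not see the averaging. -/
lemma integral_folnerAverage (hF : IsAveraging θ F) (ν : Measure X) [IsFiniteMeasure ν]
    [SMulInvariantMeasure G X ν] (n : ℕ) (f : C(X, ℝ)) :
    ∫ y, folnerAverage θ F n f y ∂ν = ∫ y, f y ∂ν := by
  have := hF.isFiniteMeasure n
  have hcont : Continuous fun p : X × G => f (p.2 • p.1) :=
    f.continuous.comp (continuous_snd.smul continuous_fst)
  have hint : Integrable (fun p : X × G => f (p.2 • p.1)) (ν.prod (θ.restrict (F n))) :=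
    Integrable.of_bound hcont.measurable.aestronglyMeasurable ‖f‖
      (Eventually.of_forall fun p => f.norm_coe_le_norm _)
  simp only [folnerAverage]
  rw [integral_const_mul, integral_integral_swap hint]
  have : ∀ g : G, ∫ y, f (g • y) ∂ν = ∫ y, f y ∂ν := fun g =>
    (smulInvariantMeasure_iff_integral_koopman ν).1 inferInstance g f
  simp only [this, integral_const, smul_eq_mul, measureReal_restrict_apply_univ]
  rw [inv_mul_cancel_left₀ (hF.real_pos n).ne']

/-- Dominated convergence in `integral_folnerAverage`; no Følner property enters. -/
lemma AveragesTendsto.integral_eq {S : C(X, ℝ) →L[ℝ] C(X, ℝ)} (hF : IsAveraging θ F)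
    (hS : AveragesTendsto θ F S) (ν : Measure X) [IsFiniteMeasure ν]
    [SMulInvariantMeasure G X ν] (f : C(X, ℝ)) :
    ∫ y, S f y ∂ν = ∫ y, f y ∂ν := by
  have hlim : Tendsto (fun n => ∫ y, folnerAverage θ F n f y ∂ν) atTop (𝓝 (∫ y, S f y ∂ν)) := by
    refine tendsto_integral_of_dominated_convergence (fun _ => ‖f‖) (fun n => ?_)
      (integrable_const _) (fun n => Eventually.of_forall fun y => abs_folnerAverage_le hF n f y)
      (Eventually.of_forall fun y => hS f y)
    have := hF.isFiniteMeasure n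
    have hcont : Continuous fun p : X × G => f (p.2 • p.1) :=
      f.continuous.comp (continuous_snd.smul continuous_fst)
    exact ((hcont.measurable.stronglyMeasurable.integral_prod_right
      (ν := θ.restrict (F n))).const_mul _).aestronglyMeasurable
  refine tendsto_nhds_unique hlim (tendsto_const_nhds.congr fun n => ?_)
  rw [integral_folnerAverage hF]

end Averages

/-! ### Asymptotic invariance of Følner averages -/

section Thick

variable {G X : Type*} [Group G] [TopologicalSpace G] [IsTopologicalGroup G] [T2Space G]
  [MeasurableSpace G] [BorelSpace G]
  [MetricSpace X] [CompactSpace X] [MeasurableSpace X] [BorelSpace X]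
  [MulAction G X] [ContinuousSMul G X] {θ : Measure G} {F : ℕ → Set G}

lemma abs_setIntegral_sub_setIntegral_le {α : Type*} [MeasurableSpace α] {m : Measure α}
    {A B : Set α} (hA : MeasurableSet A) (hB : MeasurableSet B) (hA' : m A ≠ ⊤) (hB' : m B ≠ ⊤)
    {a : α → ℝ} (ha : Measurable a) {C : ℝ} (hC : ∀ y, |a y| ≤ C) :
    |∫ y in A, a y ∂m - ∫ y in B, a y ∂m| ≤ C * m.real (A ∆ B) := by
  have hint : ∀ D : Set α, m D ≠ ⊤ → IntegrableOn a D m := fun D hD =>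
    Measure.integrableOn_of_bounded hD ha.aestronglyMeasurable (Eventually.of_forall hC)
  have hA₁ : m (A \ B) ≠ ⊤ := measure_ne_top_of_subset Set.sdiff_subset hA'
  have hB₁ : m (B \ A) ≠ ⊤ := measure_ne_top_of_subset Set.sdiff_subset hB'
  have e₁ := integral_inter_add_sdiff hB (hint A hA')
  have e₂ := integral_inter_add_sdiff hA (hint B hB')
  rw [Set.inter_comm] at e₂
  have b₁ : |∫ y in A \ B, a y ∂m| ≤ C * m.real (A \ B) :=
    norm_setIntegral_le_of_norm_le_const (f := a) (C := C) hA₁.lt_top fun y _ => hC y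
  have b₂ : |∫ y in B \ A, a y ∂m| ≤ C * m.real (B \ A) :=
    norm_setIntegral_le_of_norm_le_const (f := a) (C := C) hB₁.lt_top fun y _ => hC y
  have e₃ : m.real (A ∆ B) = m.real (A \ B) + m.real (B \ A) :=
    measureReal_union (disjoint_sdiff_sdiff) (hB.diff hA) hA₁ hB₁
  rw [e₃, ← e₁, ← e₂]
  rw [abs_le] at b₁ b₂ ⊢
  constructor <;> linarith [b₁.1, b₁.2, b₂.1, b₂.2]

lemma IsThickLeftFolner.isAveraging (hF : IsThickLeftFolner θ F) : IsAveraging θ F :=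
  have := hF.haar.1
  ⟨fun n => (hF.isCompact n).measurableSet, fun n => (hF.pos n).ne',
    fun n => (hF.isCompact n).measure_lt_top.ne⟩

lemma IsThickRightFolner.isAveraging (hF : IsThickRightFolner θ F) : IsAveraging θ F :=
  have := hF.haar.1
  ⟨fun n => (hF.isCompact n).measurableSet, fun n => (hF.pos n).ne',
    fun n => (hF.isCompact n).measure_lt_top.ne⟩

lemma tendsto_average_sub_average_of_symmDiff [θ.Regular] (hF : IsAveraging θ F) {E : ℕ → Set G}
    (hE : ∀ n, IsCompact (E n))
    (h : Tendsto (fun n => θ (F n ∆ E n) / θ (F n)) atTop (𝓝 0)) (f : C(X, ℝ)) (x : X) :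
    Tendsto (fun n => (θ.real (F n))⁻¹ * ∫ g in E n, f (g • x) ∂θ - folnerAverage θ F n f x)
      atTop (𝓝 0) := by
  have h' : Tendsto (fun n => ‖f‖ * (θ.real (F n ∆ E n) / θ.real (F n))) atTop (𝓝 0) := by
    have := (ENNReal.tendsto_toReal ENNReal.zero_ne_top).comp h
    simpa [Function.comp_def, ENNReal.toReal_div, Measure.real] using this.const_mul ‖f‖
  refine squeeze_zero_norm (fun n => ?_) h'
  rw [folnerAverage, ← mul_sub, Real.norm_eq_abs, abs_mul, abs_inv, abs_of_pos (hF.real_pos n),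
    abs_sub_comm, inv_mul_eq_div, ← mul_div_assoc]
  refine div_le_div_of_nonneg_right ?_ (hF.real_pos n).le
  exact abs_setIntegral_sub_setIntegral_le (hF.measurableSet n) (hE n).measurableSet (hF.ne_top n)
    (hE n).measure_lt_top.ne (f.continuous.comp (continuous_smul_const x)).measurable
    fun g => f.norm_coe_le_norm _

/-- By left invariance of `θ`, translating the function by `g` amounts to averaging over `g F n`; a
singleton `K` suffices. -/
theorem IsThickLeftFolner.tendsto_koopman_sub (hF : IsThickLeftFolner θ F) (g : G) (f : C(X, ℝ))
    (x : X) :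
    Tendsto (fun n => folnerAverage θ F n (koopman g f) x - folnerAverage θ F n f x)
      atTop (𝓝 0) := by
  have := hF.haar.1
  have := hF.haar.2.2
  have hlim := hF.tendsto {g} isCompact_singleton (Set.singleton_nonempty g)
  have hE : ∀ n, IsCompact ({g} * F n) := fun n => isCompact_singleton.mul (hF.isCompact n)
  have key := tendsto_average_sub_average_of_symmDiff hF.isAveraging hE hlim f x
  refine key.congr fun n => ?_
  rw [Set.singleton_mul, (measurePreserving_mul_left θ g).setIntegral_image_emb
    (Homeomorph.mulLeft g).measurableEmbedding]
  simp only [folnerAverage, koopman, ContinuousMap.comp_apply, ContinuousMap.coe_mk, mul_smul]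

/-- Right translation of `F n` moves the base point instead of the function, so here invariance of
`S f`, not of `μ x`, is what follows directly. -/
theorem IsThickRightFolner.tendsto_smul_sub (hF : IsThickRightFolner θ F) (g : G) (f : C(X, ℝ))
    (x : X) :
    Tendsto (fun n => folnerAverage θ F n f (g • x) - folnerAverage θ F n f x)
      atTop (𝓝 0) := by
  have := hF.haar.1
  have := hF.haar.2.2
  have hlim := hF.tendsto {g} isCompact_singleton (Set.singleton_nonempty g)
  have hE : ∀ n, IsCompact (F n * {g}) := fun n => (hF.isCompact n).mul isCompact_singleton
  have key := tendsto_average_sub_average_of_symmDiff hF.isAveraging hE hlim f x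
  refine key.congr fun n => ?_
  rw [Set.mul_singleton, (measurePreserving_mul_right θ g).setIntegral_image_emb
    (Homeomorph.mulRight g).measurableEmbedding]
  simp only [folnerAverage, mul_smul]

end Thick

/-! ### Comparing sums over almost perfectly matched finite sets. -/

section Matching

variable {G : Type*}

/-- The maximal cardinality of an injective partial matching between `F` and `E` in the
relation `r`. -/
noncomputable def relMatchingNumber (r : G → G → Prop) (F E : Set G) : ℕ :=
  sSup {k | ∃ M ⊆ F, M.ncard = k ∧ ∃ φ : G → G,
    Set.InjOn φ M ∧ Set.MapsTo φ M E ∧ ∀ f ∈ M, r f (φ f)}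

lemma exists_matching (r : G → G → Prop) {F : Set G} (hF : F.Finite) (E : Set G) :
    ∃ M ⊆ F, M.ncard = relMatchingNumber r F E ∧ ∃ φ : G → G,
      Set.InjOn φ M ∧ Set.MapsTo φ M E ∧ ∀ f ∈ M, r f (φ f) :=
  Nat.sSup_mem (s := {k | ∃ M ⊆ F, M.ncard = k ∧ ∃ φ : G → G,
      Set.InjOn φ M ∧ Set.MapsTo φ M E ∧ ∀ f ∈ M, r f (φ f)})
    ⟨0, ∅, Set.empty_subset _, Set.ncard_empty _, id, by simp, by simp [Set.MapsTo], by simp⟩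
    ⟨F.ncard, by rintro _ ⟨M, hM, rfl, -⟩; exact Set.ncard_le_ncard hM hF⟩

/-- Matched terms differ by at most `ε`. As `E` and `F` have equal size, each has `F.card - M.card`
unmatched elements. -/
lemma abs_sum_sub_sum_le_of_matching (F E M : Finset G) (hM : M ⊆ F) (hcard : E.card = F.card)
    {φ : G → G} (hinj : Set.InjOn φ M) (hmaps : ∀ f ∈ M, φ f ∈ E) {a : G → ℝ} {C ε : ℝ}
    (hC : ∀ g, |a g| ≤ C) (hε : 0 ≤ ε) (ha : ∀ f ∈ M, |a (φ f) - a f| ≤ ε) :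
    |∑ g ∈ E, a g - ∑ g ∈ F, a g| ≤ ε * F.card + 2 * C * (F.card - M.card) := by
  classical
  have hsub : M.image φ ⊆ E := Finset.image_subset_iff.2 hmaps
  have hcM : (M.image φ).card = M.card := Finset.card_image_of_injOn hinj
  have e₁ := Finset.sum_sdiff (f := a) hsub
  have e₂ := Finset.sum_sdiff (f := a) hM
  rw [Finset.sum_image hinj] at e₁
  have b₁ : |∑ g ∈ E \ M.image φ, a g| ≤ C * (F.card - M.card) := by
    refine (Finset.abs_sum_le_sum_abs _ _).trans ((Finset.sum_le_card_nsmul _ _ C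
      fun g _ => hC g).trans (le_of_eq ?_))
    rw [nsmul_eq_mul, Finset.cast_card_sdiff hsub, hcM, hcard, mul_comm]
  have b₂ : |∑ g ∈ F \ M, a g| ≤ C * (F.card - M.card) := by
    refine (Finset.abs_sum_le_sum_abs _ _).trans ((Finset.sum_le_card_nsmul _ _ C
      fun g _ => hC g).trans (le_of_eq ?_))
    rw [nsmul_eq_mul, Finset.cast_card_sdiff hM, mul_comm]
  have b₃ : |∑ g ∈ M, a (φ g) - ∑ g ∈ M, a g| ≤ ε * F.card := by
    rw [← Finset.sum_sub_distrib]
    refine (Finset.abs_sum_le_sum_abs _ _).trans ((Finset.sum_le_card_nsmul _ _ ε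
      fun g hg => ha g hg).trans ?_)
    rw [nsmul_eq_mul, mul_comm]
    exact mul_le_mul_of_nonneg_left (by exact_mod_cast Finset.card_le_card hM) hε
  rw [← e₁, ← e₂]
  rw [abs_le] at b₁ b₂ b₃ ⊢
  constructor <;> linarith [b₁.1, b₁.2, b₂.1, b₂.2, b₃.1, b₃.2]

lemma abs_sum_sub_sum_le (r : G → G → Prop) {F E : Set G} (hF : F.Finite) (hE : E.Finite)
    (hcard : E.ncard = F.ncard) {a : G → ℝ} {C ε : ℝ} (hC : ∀ g, |a g| ≤ C) (hε : 0 ≤ ε)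
    (ha : ∀ f h, r f h → |a h - a f| ≤ ε) :
    |∑ g ∈ hE.toFinset, a g - ∑ g ∈ hF.toFinset, a g|
      ≤ ε * F.ncard + 2 * C * (F.ncard - relMatchingNumber r F E) := by
  obtain ⟨M, hM, hk, φ, hinj, hmaps, hr⟩ := exists_matching r hF E
  have hMf := hF.subset hM
  rw [← hk, Set.ncard_eq_toFinset_card _ hF, Set.ncard_eq_toFinset_card _ hMf]
  rw [Set.ncard_eq_toFinset_card _ hF, Set.ncard_eq_toFinset_card _ hE] at hcard
  refine abs_sum_sub_sum_le_of_matching _ _ _ (by simpa using hM) hcard (φ := φ)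
    (by simpa using hinj) (fun f hf => ?_) hC hε fun f hf => ha _ _ (hr f (by simpa using hf))
  simpa using hmaps (by simpa using hf)

/-- If almost all of `F n` can be matched with `E n`, with matched elements at which `a` is close,
then the averages of `a` over `F n` and `E n` are asymptotically equal. -/
lemma tendsto_sum_sub_sum {F E : ℕ → Set G} (hF : ∀ n, (F n).Finite) (hE : ∀ n, (E n).Finite)
    (hne : ∀ n, (F n).Nonempty) (hcard : ∀ n, (E n).ncard = (F n).ncard) {a : G → ℝ} {C : ℝ}
    (hC : ∀ g, |a g| ≤ C)
    (h : ∀ ε > 0, ∃ r : G → G → Prop, (∀ f h, r f h → |a h - a f| ≤ ε) ∧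
      Tendsto (fun n => (relMatchingNumber r (F n) (E n) : ℝ) / (F n).ncard) atTop (𝓝 1)) :
    Tendsto (fun n => ((F n).ncard : ℝ)⁻¹ *
      (∑ g ∈ (hE n).toFinset, a g - ∑ g ∈ (hF n).toFinset, a g)) atTop (𝓝 0) := by
  rw [Metric.tendsto_nhds]
  intro ε hε
  obtain ⟨r, hr, hlim⟩ := h (ε / 2) (half_pos hε)
  have hlim' : Tendsto (fun n => ε / 2 + 2 * C *
      (1 - (relMatchingNumber r (F n) (E n) : ℝ) / (F n).ncard)) atTop (𝓝 (ε / 2)) := by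
    simpa using ((hlim.const_sub 1).const_mul (2 * C)).const_add (ε / 2)
  filter_upwards [hlim'.eventually_lt_const (half_lt_self hε)] with n hn
  have hpos : (0 : ℝ) < (F n).ncard := by exact_mod_cast (Set.ncard_pos (hF n)).2 (hne n)
  have key := abs_sum_sub_sum_le r (hF n) (hE n) (hcard n) hC (half_pos hε).le hr
  rw [Real.dist_eq, sub_zero, abs_mul, abs_inv, abs_of_pos hpos, inv_mul_lt_iff₀ hpos]
  refine key.trans_lt ?_
  have := mul_lt_mul_of_pos_left hn hpos
  refine lt_of_eq_of_lt ?_ this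
  field_simp

end Matching

/-! ### Averages over thin Følner sequences. -/

section Thin

variable {G X : Type*} [Group G] [TopologicalSpace G] [IsTopologicalGroup G] [T2Space G]
  [MeasurableSpace G] [BorelSpace G]
  [MetricSpace X] [CompactSpace X] [MeasurableSpace X] [BorelSpace X]
  [MulAction G X] [ContinuousSMul G X] {θ : Measure G} {F : ℕ → Set G}

lemma isAveraging_count (hF : ∀ n, (F n).Finite) (hne : ∀ n, (F n).Nonempty) :
    IsAveraging Measure.count F :=
  ⟨fun n => (hF n).measurableSet, fun n => Measure.count_ne_zero (hne n),
    fun n => (Measure.count_apply_lt_top.2 (hF n)).ne⟩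

lemma setIntegral_count {s : Set G} (hs : s.Finite) (a : G → ℝ) :
    ∫ g in s, a g ∂Measure.count = ∑ g ∈ hs.toFinset, a g := by
  have hint : IntegrableOn a s Measure.count := by
    have := (integrableOn_finite_biUnion (μ := Measure.count) (f := a) (t := fun x : G => {x}) hs).2
      fun x _ => integrableOn_singleton (hx := by simp)
    rwa [Set.biUnion_of_singleton] at this
  rw [setIntegral_countable a hs.countable hint]
  simp only [count_real_singleton, one_smul]
  obtain ⟨t, rfl⟩ := hs.exists_finset_coe
  exact (Finset.tsum_subtype' t a).trans (by simp)

lemma folnerAverage_count (hF : ∀ n, (F n).Finite) (n : ℕ) (f : C(X, ℝ)) (x : X) :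
    folnerAverage Measure.count F n f x
      = ((F n).ncard : ℝ)⁻¹ * ∑ g ∈ (hF n).toFinset, f (g • x) := by
  rw [folnerAverage, setIntegral_count (hF n), Measure.real, Measure.count_apply_finite _ (hF n),
    Set.ncard_eq_toFinset_card _ (hF n)]
  simp

lemma sum_singleton_mul {s : Set G} (hs : s.Finite) (g : G) (a : G → ℝ) :
    ∑ h ∈ ((Set.finite_singleton g).mul hs).toFinset, a h = ∑ h ∈ hs.toFinset, a (g * h) := by
  classical
  rw [← Finset.sum_image (f := a) (g := fun h => g * h) (fun _ _ _ _ h => mul_left_cancel h)]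
  congr 1
  ext
  simp [Set.singleton_mul]

lemma sum_mul_singleton {s : Set G} (hs : s.Finite) (g : G) (a : G → ℝ) :
    ∑ h ∈ (hs.mul (Set.finite_singleton g)).toFinset, a h = ∑ h ∈ hs.toFinset, a (h * g) := by
  classical
  rw [← Finset.sum_image (f := a) (g := fun h => h * g) (fun _ _ _ _ h => mul_right_cancel h)]
  congr 1
  ext
  simp [Set.mul_singleton]

lemma ncard_singleton_mul (s : Set G) (g : G) : (({g} : Set G) * s).ncard = s.ncard := by
  rw [Set.singleton_mul]
  exact Set.ncard_image_of_injective _ (mul_right_injective g)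

lemma ncard_mul_singleton (s : Set G) (g : G) : (s * {g}).ncard = s.ncard := by
  rw [Set.mul_singleton]
  exact Set.ncard_image_of_injective _ (mul_left_injective g)

/-- Group elements close to the identity move all points uniformly little. -/
lemma exists_isOpen_abs_smul_sub_lt (f : C(X, ℝ)) {ε : ℝ} (hε : 0 < ε) :
    ∃ V : Set G, IsOpen V ∧ (1 : G) ∈ V ∧ ∀ v ∈ V, ∀ y : X, |f (v • y) - f y| < ε := by
  have hcont : Continuous fun z : G × X => |f (z.1 • z.2) - f z.2| := by fun_prop
  have h : ∀ᶠ v in 𝓝 (1 : G), ∀ y ∈ (Set.univ : Set X), |f (v • y) - f y| < ε :=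
    isCompact_univ.eventually_forall_of_forall_eventually fun y _ =>
      hcont.continuousAt.eventually_lt_const (by simpa using hε)
  obtain ⟨V, hV, hVo, h1⟩ := eventually_nhds_iff.1 h
  exact ⟨V, hVo, h1, fun v hv y => hV v hv y (Set.mem_univ y)⟩

/-- Matched elements differ by a left factor in `V`, which acts last and hence moves every point of
the orbit uniformly little. -/
lemma exists_rel_of_matchingNumber {E : ℕ → Set G} (h : ∀ V : Set G, IsOpen V → (1 : G) ∈ V →
      Tendsto (fun n => (matchingNumber V (F n) (E n) : ℝ) / ((F n).ncard : ℝ)) atTop (𝓝 1))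
    (f : C(X, ℝ)) (x : X) {ε : ℝ} (hε : 0 < ε) :
    ∃ r : G → G → Prop, (∀ u v, r u v → |f (v • x) - f (u • x)| ≤ ε) ∧
      Tendsto (fun n => (relMatchingNumber r (F n) (E n) : ℝ) / (F n).ncard) atTop (𝓝 1) := by
  obtain ⟨V, hVo, h1, hV⟩ := exists_isOpen_abs_smul_sub_lt (G := G) f hε
  have e : ∀ n, relMatchingNumber (fun u v => v ∈ V * {u}) (F n) (E n)
      = matchingNumber V (F n) (E n) := fun n => rfl
  refine ⟨fun u v => v ∈ V * {u}, fun u w hw => ?_, by simpa only [e] using h V hVo h1⟩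
  obtain ⟨v, hv, _, rfl, rfl⟩ := Set.mem_mul.1 hw
  rw [mul_smul]
  exact (hV v hv _).le

theorem IsThinLeftFolner.tendsto_koopman_sub (hF : IsThinLeftFolner θ F) (g : G) (f : C(X, ℝ))
    (x : X) :
    Tendsto (fun n => folnerAverage θ F n (koopman g f) x - folnerAverage θ F n f x)
      atTop (𝓝 0) := by
  obtain ⟨rfl, hfin, hne, hlim⟩ := hF
  refine (tendsto_sum_sub_sum hfin (fun n => (Set.finite_singleton g).mul (hfin n)) hne
    (fun n => ncard_singleton_mul _ g) (a := fun h => f (h • x)) (C := ‖f‖)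
    (fun h => f.norm_coe_le_norm _)
    fun ε hε => exists_rel_of_matchingNumber (hlim g) f x hε).congr fun n => ?_
  rw [sum_singleton_mul (hfin n), folnerAverage_count hfin, folnerAverage_count hfin, ← mul_sub]
  simp only [koopman, ContinuousMap.comp_apply, ContinuousMap.coe_mk, mul_smul]

theorem IsThinRightFolner.tendsto_smul_sub (hF : IsThinRightFolner θ F) (g : G) (f : C(X, ℝ))
    (x : X) :
    Tendsto (fun n => folnerAverage θ F n f (g • x) - folnerAverage θ F n f x)
      atTop (𝓝 0) := by
  obtain ⟨rfl, hfin, hne, hlim⟩ := hF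
  refine (tendsto_sum_sub_sum hfin (fun n => (hfin n).mul (Set.finite_singleton g)) hne
    (fun n => ncard_mul_singleton _ g) (a := fun h => f (h • x)) (C := ‖f‖)
    (fun h => f.norm_coe_le_norm _)
    fun ε hε => exists_rel_of_matchingNumber (hlim g) f x hε).congr fun n => ?_
  rw [sum_mul_singleton (hfin n), folnerAverage_count hfin, folnerAverage_count hfin, ← mul_sub]
  simp only [mul_smul]

/-! ### Mirrored thin right Følner sequences in locally compact groups -/

/-- Averages over a compact set `K` of group elements depend left uniformly continuously on the
group element they are translated by. -/
lemma exists_isOpen_abs_setIntegral_sub_le [LocallyCompactSpace G] (m : Measure G) [m.IsHaarMeasure]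
    [m.Regular] {K : Set G} (hK : IsCompact K) (f : C(X, ℝ)) (x : X) {ε : ℝ} (hε : 0 < ε) :
    ∃ V : Set G, IsOpen V ∧ (1 : G) ∈ V ∧ ∀ w ∈ V, ∀ h : G,
      |∫ v in K, f ((h * w * v) • x) ∂m - ∫ v in K, f ((h * v) • x) ∂m| ≤ ε := by
  -- Each half of the symmetric difference of `w • K` and `K` gets measure at most `δ`; the summand
  -- 1 covers `f = 0`.
  set δ : ℝ := ε / (2 * (‖f‖ + 1)) with hδ
  have hδ0 : 0 < δ := by positivity
  have h₁ : ∀ᶠ w in 𝓝 (1 : G), m (w • K \ K) < ENNReal.ofReal δ :=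
    eventually_nhds_one_measure_smul_sdiff_lt hK hK.isClosed (by simpa using hδ0)
  have h₂ : ∀ᶠ w in 𝓝 (1 : G), m (w⁻¹ • K \ K) < ENNReal.ofReal δ := by
    have : Tendsto (fun w : G => w⁻¹) (𝓝 1) (𝓝 1) := by
      simpa using (continuous_inv (G := G)).tendsto 1
    exact this.eventually h₁
  obtain ⟨V, hV, hVo, h1⟩ := eventually_nhds_iff.1 (h₁.and h₂)
  refine ⟨V, hVo, h1, fun w hw h => ?_⟩
  have hwK : IsCompact (w • K) := hK.smul w
  -- Left invariance of `m` moves `w` from the integrand to the domain, where its effect no longer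
  -- depends on `h`.
  have e : ∫ v in K, f ((h * w * v) • x) ∂m = ∫ v in w • K, f ((h * v) • x) ∂m := by
    rw [← Set.image_smul]
    simp only [smul_eq_mul, mul_assoc]
    exact ((measurePreserving_mul_left m w).setIntegral_image_emb
      (Homeomorph.mulLeft w).measurableEmbedding (fun v => f ((h * v) • x)) K).symm
  rw [e]
  have hcont : Continuous fun v : G => f ((h * v) • x) :=
    f.continuous.comp ((continuous_const_mul h).smul continuous_const)
  refine (abs_setIntegral_sub_setIntegral_le hwK.measurableSet hK.measurableSet
    hwK.measure_lt_top.ne hK.measure_lt_top.ne hcont.measurable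
    fun v => f.norm_coe_le_norm _).trans ?_
  have r₁ : m.real (w • K \ K) ≤ δ := ENNReal.toReal_le_of_le_ofReal hδ0.le (hV w hw).1.le
  have r₂ : m.real (K \ w • K) ≤ δ := by
    have : K \ w • K = w • (w⁻¹ • K \ K) := by rw [Set.smul_set_sdiff, smul_inv_smul]
    rw [this]
    refine ENNReal.toReal_le_of_le_ofReal hδ0.le ?_
    rw [measure_smul]
    exact (hV w hw).2.le
  have r₃ : m.real ((w • K) ∆ K) ≤ 2 * δ := (measureReal_union_le _ _).trans (by linarith)
  calc ‖f‖ * m.real ((w • K) ∆ K) ≤ (‖f‖ + 1) * (2 * δ) := by gcongr; linarith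
    _ = ε := by rw [hδ]; field_simp

/-- Here matched elements differ by a right factor, whose effect on `f (h • x)` need not be small
uniformly in `h`. The matching argument is therefore applied to `h ↦ ∫ v in K, f ((h * v) • x) ∂m`.
-/
theorem IsMirroredThinRightFolner.integral_eq [LocallyCompactSpace G]
    (hF : IsMirroredThinRightFolner θ F) {S : C(X, ℝ) →L[ℝ] C(X, ℝ)}
    (hS : AveragesTendsto θ F S) (m : Measure G) [m.IsHaarMeasure] [m.Regular] {K : Set G}
    (hK : IsCompact K) (g : G) (f : C(X, ℝ)) (x : X) :
    ∫ v in K, S f (g • v • x) ∂m = ∫ v in K, S f (v • x) ∂m := by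
  obtain ⟨rfl, hfin, hne, hlim⟩ := hF
  have hav := isAveraging_count hfin hne
  have hKfin : IsFiniteMeasure (m.restrict K) :=
    ⟨by rw [Measure.restrict_apply_univ]; exact hK.measure_lt_top⟩
  have hint : ∀ h : G, Integrable (fun v => f ((h * v) • x)) (m.restrict K) := fun h =>
    Integrable.of_bound (f.continuous.comp
      ((continuous_const_mul h).smul continuous_const)).measurable.aestronglyMeasurable ‖f‖
      (Eventually.of_forall fun v => f.norm_coe_le_norm _)
  have hC : ∀ h : G, |∫ v in K, f ((h * v) • x) ∂m| ≤ ‖f‖ * m.real K := fun h =>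
    norm_setIntegral_le_of_norm_le_const hK.measure_lt_top fun v _ => f.norm_coe_le_norm _
  have hlim₀ := tendsto_sum_sub_sum hfin (fun n => (hfin n).mul (Set.finite_singleton g)) hne
    (fun n => ncard_mul_singleton _ g) (a := fun h => ∫ v in K, f ((h * v) • x) ∂m) hC
    fun ε hε => by
      obtain ⟨V, hVo, h1, hV⟩ := exists_isOpen_abs_setIntegral_sub_le m hK f x hε
      have e : ∀ n, relMatchingNumber (fun u v => v ∈ ({u} : Set G) * V) (F n) (F n * {g})
          = mirroredMatchingNumber V (F n) (F n * {g}) := fun n => rfl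
      refine ⟨fun u v => v ∈ ({u} : Set G) * V, fun u w hw => ?_,
        by simpa only [e] using hlim g V hVo h1⟩
      obtain ⟨_, rfl, v, hv, rfl⟩ := Set.mem_mul.1 hw
      exact hV v hv _
  -- Averaging over `F n` commutes with integration over `K`, so dominated convergence identifies
  -- the limit.
  have hdom : ∀ u : G, Tendsto (fun n => ((F n).ncard : ℝ)⁻¹ *
      ∑ h ∈ (hfin n).toFinset, ∫ v in K, f ((h * u * v) • x) ∂m) atTop
      (𝓝 (∫ v in K, S f (u • v • x) ∂m)) := by
    intro u
    have : Tendsto (fun n => ∫ v in K, folnerAverage Measure.count F n f (u • v • x) ∂m) atTop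
        (𝓝 (∫ v in K, S f (u • v • x) ∂m)) := by
      refine tendsto_integral_of_dominated_convergence (fun _ => ‖f‖) (fun n => ?_)
        (integrable_const _) (fun n => Eventually.of_forall fun v => abs_folnerAverage_le hav n f _)
        (Eventually.of_forall fun v => hS f _)
      simp only [folnerAverage_count hfin]
      exact Continuous.measurable (by fun_prop) |>.aestronglyMeasurable
    refine this.congr fun n => ?_
    simp only [folnerAverage_count hfin]
    rw [integral_const_mul, integral_finsetSum]
    · simp only [mul_smul]
    · intro h _
      simpa only [mul_smul] using hint (h * u)
  have h₁ := hdom g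
  have h₂ := hdom 1
  simp only [mul_one, one_smul] at h₂
  have h₃ := h₁.sub h₂
  refine sub_eq_zero.1 (tendsto_nhds_unique h₃ (hlim₀.congr fun n => ?_))
  rw [sum_mul_singleton, mul_sub]

/-- Continuity of `S f` undoes the smoothing: a strict inequality at `x` would persist on a compact
neighbourhood `K` of the identity and contradict equality of the integrals over `K`. -/
theorem IsMirroredThinRightFolner.apply_smul [LocallyCompactSpace G]
    (hF : IsMirroredThinRightFolner θ F) {S : C(X, ℝ) →L[ℝ] C(X, ℝ)}
    (hS : AveragesTendsto θ F S) (g : G) (f : C(X, ℝ)) (x : X) :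
    S f (g • x) = S f x := by
  suffices h : ∀ f : C(X, ℝ), S f (g • x) ≤ S f x from
    le_antisymm (h f) (by simpa using h (-f))
  intro f
  by_contra! hlt
  have hcont : Continuous fun v : G => S f (g • v • x) - S f (v • x) := by fun_prop
  have hnhds : {v : G | 0 < S f (g • v • x) - S f (v • x)} ∈ 𝓝 (1 : G) :=
    (isOpen_lt continuous_const hcont).mem_nhds (by simpa using hlt)
  obtain ⟨K, hK1, hKsub, hK⟩ := local_compact_nhds hnhds
  let m : Measure G := Measure.haar
  have hKfin : IsFiniteMeasure (m.restrict K) :=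
    ⟨by rw [Measure.restrict_apply_univ]; exact hK.measure_lt_top⟩
  have hint : ∀ u : G, Integrable (fun v => S f (u • v • x)) (m.restrict K) := fun u =>
    Integrable.of_bound (Continuous.measurable (by fun_prop)).aestronglyMeasurable ‖S f‖
      (Eventually.of_forall fun v => (S f).norm_coe_le_norm _)
  have hint1 : Integrable (fun v => S f (v • x)) (m.restrict K) := by
    simpa only [one_smul] using hint 1
  have h0 : ∫ v in K, (S f (g • v • x) - S f (v • x)) ∂m = 0 := by
    rw [integral_sub (hint g) hint1, hF.integral_eq hS m hK g f x, sub_self]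
  refine (((setIntegral_pos_iff_support_of_nonneg_ae ?_ ((hint g).sub hint1)).2 ?_).ne' h0)
  · exact (ae_restrict_mem hK.measurableSet).mono fun v hv => (hKsub hv).le
  · refine (Measure.measure_pos_of_mem_nhds m hK1).trans_le (measure_mono fun v hv => ?_)
    exact ⟨(hKsub hv).ne', hv⟩

end Thin

/-! ### Operators given by invariant measures -/

section Kernel

variable {G X : Type*} [Group G] [TopologicalSpace G] [IsTopologicalGroup G]
  [MetricSpace X] [CompactSpace X] [MeasurableSpace X] [BorelSpace X]
  [MulAction G X] [ContinuousSMul G X]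

/-- The operator `S` is given by the `G`-invariant probability measures `μ x`, and it preserves
the integral with respect to every invariant measure. -/
structure IsInvariantKernel (G : Type*) {X : Type*} [Group G] [TopologicalSpace G] [MetricSpace X]
    [CompactSpace X] [MeasurableSpace X] [MulAction G X] (S : C(X, ℝ) →L[ℝ] C(X, ℝ))
    (μ : X → ProbabilityMeasure X) : Prop where
  apply_eq : ∀ (f : C(X, ℝ)) (x : X), S f x = ∫ y, f y ∂(μ x : Measure X)
  invariant : ∀ x, SMulInvariantMeasure G X (μ x : Measure X)
  integral_eq : ∀ (ν : Measure X), IsFiniteMeasure ν → SMulInvariantMeasure G X ν →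
    ∀ f : C(X, ℝ), ∫ y, S f y ∂ν = ∫ y, f y ∂ν

variable {S : C(X, ℝ) →L[ℝ] C(X, ℝ)} {μ : X → ProbabilityMeasure X}

namespace IsInvariantKernel

lemma idempotent (h : IsInvariantKernel G S μ) (f : C(X, ℝ)) : S (S f) = S f := by
  ext x
  rw [h.apply_eq, h.integral_eq _ inferInstance (h.invariant x), ← h.apply_eq]

lemma apply_koopman (h : IsInvariantKernel G S μ) (g : G) (f : C(X, ℝ)) :
    S (koopman g f) = S f := by
  ext x
  rw [h.apply_eq, h.apply_eq]
  exact (smulInvariantMeasure_iff_integral_koopman _).1 (h.invariant x) g f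

/-- The variance of `f` under `μ x` is nonnegative. -/
lemma sq_apply_le (h : IsInvariantKernel G S μ) (f : C(X, ℝ)) (x : X) :
    S f x * S f x ≤ S (f * f) x := by
  set c := S f x with hc
  have h₀ : 0 ≤ S ((f - c • 1) * (f - c • 1)) x := by
    rw [h.apply_eq]
    exact integral_nonneg fun y => mul_self_nonneg _
  have h₁ : S 1 x = 1 := by simp [h.apply_eq]
  have e : (f - c • 1) * (f - c • 1) = f * f - (2 * c) • f + (c * c) • (1 : C(X, ℝ)) := by
    ext y
    simp
    ring
  rw [e, map_add, map_sub, map_smul, map_smul] at h₀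
  simp only [ContinuousMap.add_apply, ContinuousMap.sub_apply, ContinuousMap.smul_apply,
    smul_eq_mul, h₁, ← hc] at h₀
  linarith

lemma integral_sq_le (h : IsInvariantKernel G S μ) (ν : Measure X) [IsFiniteMeasure ν]
    (hν : SMulInvariantMeasure G X ν) (f : C(X, ℝ)) :
    ∫ y, (S f * S f) y ∂ν ≤ ∫ y, (f * f) y ∂ν := by
  rw [← h.integral_eq ν inferInstance hν (f * f)]
  exact integral_mono (integrable_continuousMap ν _) (integrable_continuousMap ν _)
    fun y => h.sq_apply_le f y

/-- As an idempotent contraction, `S` is an orthogonal projection for every invariant measure. -/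
lemma integral_mul_apply (h : IsInvariantKernel G S μ) (ν : Measure X) [IsFiniteMeasure ν]
    (hν : SMulInvariantMeasure G X ν) (f k : C(X, ℝ)) :
    ∫ y, (f * S k) y ∂ν = ∫ y, (S f * S k) y ∂ν := by
  set b := ∫ y, ((f - S f) * S k) y ∂ν with hb
  set c := ∫ y, ((f - S f) * (f - S f)) y ∂ν with hc
  have hc0 : 0 ≤ c := integral_nonneg fun y => mul_self_nonneg _
  have key : ∀ t : ℝ, 0 ≤ 2 * t * b + t * t * c := by
    intro t
    have h₁ := h.integral_sq_le ν hν (S k + t • (f - S f))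
    have e₁ : S (S k + t • (f - S f)) = S k := by
      simp [h.idempotent]
    have e₂ : (S k + t • (f - S f)) * (S k + t • (f - S f)) = S k * S k +
        ((2 * t) • ((f - S f) * S k) + (t * t) • ((f - S f) * (f - S f))) := by
      ext y
      simp
      ring
    have e₃ : ∫ y, (S k * S k + ((2 * t) • ((f - S f) * S k) +
        (t * t) • ((f - S f) * (f - S f)))) y ∂ν
        = ∫ y, (S k * S k) y ∂ν + (2 * t * b + t * t * c) := by
      rw [hb, hc, ← integral_const_mul, ← integral_const_mul, ← integral_add, ← integral_add]
      · rfl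
      · exact integrable_continuousMap ν _
      · exact integrable_continuousMap ν ((2 * t) • ((f - S f) * S k) +
          (t * t) • ((f - S f) * (f - S f)))
      · exact (integrable_continuousMap ν ((f - S f) * S k)).const_mul _
      · exact (integrable_continuousMap ν ((f - S f) * (f - S f))).const_mul _
    rw [e₁, e₂, e₃] at h₁
    linarith
  have hb0 : b = 0 := by
    -- The denominator `c + 1`, unlike the minimizer's `c`, is never zero.
    have h₁ := key (-b / (c + 1))
    have e : 2 * (-b / (c + 1)) * b + -b / (c + 1) * (-b / (c + 1)) * c
        = -(b ^ 2 * (c + 2)) / (c + 1) ^ 2 := by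
      field_simp
      ring
    rw [e, le_div_iff₀ (by positivity), zero_mul] at h₁
    have h₂ : b ^ 2 * 2 ≤ b ^ 2 * (c + 2) := by gcongr; linarith
    have h₃ : b ^ 2 = 0 := le_antisymm (by linarith) (sq_nonneg b)
    exact pow_eq_zero_iff two_ne_zero |>.1 h₃
  have e : b = ∫ y, (f * S k) y ∂ν - ∫ y, (S f * S k) y ∂ν := by
    rw [hb, ← integral_sub (integrable_continuousMap ν _) (integrable_continuousMap ν _), sub_mul]
    rfl
  linarith

theorem seever (h : IsInvariantKernel G S μ) (f k : C(X, ℝ)) : S (f * S k) = S (S f * S k) := by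
  ext x
  rw [h.apply_eq, h.apply_eq]
  exact h.integral_mul_apply _ (h.invariant x) f k

lemma ae_eq_zero_of_integral_mul_self {ν : Measure X} [IsFiniteMeasure ν] {d : C(X, ℝ)}
    (hd : ∫ y, (d * d) y ∂ν = 0) : ∀ᵐ y ∂ν, d y = 0 := by
  have hnn : 0 ≤ fun y => (d * d) y := fun y => mul_self_nonneg (d y)
  rw [integral_eq_zero_iff_of_nonneg hnn (integrable_continuousMap ν (d * d))] at hd
  filter_upwards [hd] with y hy
  exact mul_self_eq_zero.1 hy

/-- The functions `S k` are almost everywhere invariant. -/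
lemma ae_apply_smul_eq (h : IsInvariantKernel G S μ) (ν : Measure X) [IsFiniteMeasure ν]
    (hν : SMulInvariantMeasure G X ν) (g : G) (k : C(X, ℝ)) :
    ∀ᵐ y ∂ν, S k (g • y) = S k y := by
  have key : ∀ f : C(X, ℝ), ∫ y, (f * (koopman g (S k) - S k)) y ∂ν = 0 := by
    intro f
    -- Invariance of `ν` shifts `g` onto `f`, and projecting by `S` absorbs it. The final test
    -- function is the difference itself.
    have e₁ : ∫ y, (f * koopman g (S k)) y ∂ν = ∫ y, (f * S k) y ∂ν := by
      have e : f * koopman g (S k) = koopman g (koopman g⁻¹ f * S k) := by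
        ext y
        simp [koopman]
      rw [e, (smulInvariantMeasure_iff_integral_koopman ν).1 hν, h.integral_mul_apply ν hν,
        h.apply_koopman, ← h.integral_mul_apply ν hν]
    have e₂ : ∫ y, (f * (koopman g (S k) - S k)) y ∂ν
        = ∫ y, (f * koopman g (S k)) y ∂ν - ∫ y, (f * S k) y ∂ν := by
      rw [← integral_sub (integrable_continuousMap ν _) (integrable_continuousMap ν _), mul_sub]
      rfl
    rw [e₂, e₁, sub_self]
  filter_upwards [ae_eq_zero_of_integral_mul_self (key (koopman g (S k) - S k))] with y hy
  exact sub_eq_zero.1 hy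

/-- For an ergodic measure `μ x`, the functions `S k` are almost everywhere constant. -/
lemma ae_eq_of_ergodic (h : IsInvariantKernel G S μ) {x : X}
    (hx : ErgodicSMul G X (μ x : Measure X)) (k : C(X, ℝ)) :
    ∀ᵐ y ∂(μ x : Measure X), S k y = S k x := by
  have hint : Integrable (fun y => S k y - S k x) (μ x : Measure X) :=
    (integrable_continuousMap _ (S k)).sub (integrable_const _)
  have h0 : ∫ y, (S k y - S k x) ∂(μ x : Measure X) = 0 := by
    rw [integral_sub (integrable_continuousMap _ (S k)) (integrable_const _), ← h.apply_eq,
      h.idempotent]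
    simp
  -- The level `S k x` is the mean of `S k` under `μ x`. If the set is null or conull, the deviation
  -- from the mean has constant sign and thus vanishes almost everywhere.
  have hs : EventuallyConst {y | S k x < S k y} (ae (μ x : Measure X)) :=
    hx.aeconst_of_forall_preimage_smul_ae_eq
      (isOpen_lt continuous_const (S k).continuous).measurableSet fun g => by
        filter_upwards [h.ae_apply_smul_eq _ (h.invariant x) g k] with y hy
        change (S k x < S k (g • y)) = (S k x < S k y)
        rw [hy]
  rcases eventuallyConst_set.1 hs with hs | hs
  · have hnn : 0 ≤ᵐ[(μ x : Measure X)] fun y => S k y - S k x := by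
      filter_upwards [hs] with y hy
      exact sub_nonneg.2 (le_of_lt hy)
    filter_upwards [(integral_eq_zero_iff_of_nonneg_ae hnn hint).1 h0] with y hy
    exact sub_eq_zero.1 hy
  · have hnn : 0 ≤ᵐ[(μ x : Measure X)] fun y => -(S k y - S k x) := by
      filter_upwards [hs] with y hy
      have : S k y ≤ S k x := not_lt.1 hy
      simp only [Pi.zero_apply]
      linarith
    have h0' : ∫ y, -(S k y - S k x) ∂(μ x : Measure X) = 0 := by rw [integral_neg, h0, neg_zero]
    filter_upwards [(integral_eq_zero_iff_of_nonneg_ae hnn hint.neg).1 h0'] with y hy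
    have : -(S k y - S k x) = 0 := hy
    linarith

/-- If `S` is an averaging operator, the functions `S k` are almost everywhere constant for each
`μ x`. -/
lemma ae_eq_of_averaging (h : IsInvariantKernel G S μ)
    (hav : ∀ f k : C(X, ℝ), S (f * S k) = S f * S k) (x : X) (k : C(X, ℝ)) :
    ∀ᵐ y ∂(μ x : Measure X), S k y = S k x := by
  -- This is the variance of `S k`; the averaging identity gives `S (S k * S k) = S k * S k`.
  have h0 : ∫ y, ((S k - S k x • 1) * (S k - S k x • 1)) y ∂(μ x : Measure X) = 0 := by
    rw [← h.apply_eq]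
    have e : (S k - S k x • 1) * (S k - S k x • 1)
        = S k * S k - (2 * S k x) • S k + (S k x * S k x) • (1 : C(X, ℝ)) := by
      ext y
      simp
      ring
    have h₁ : S 1 x = 1 := by simp [h.apply_eq]
    rw [e, map_add, map_sub, map_smul, map_smul, hav, h.idempotent]
    simp only [ContinuousMap.add_apply, ContinuousMap.sub_apply, ContinuousMap.smul_apply,
      ContinuousMap.mul_apply, smul_eq_mul, h₁]
    ring
  filter_upwards [ae_eq_zero_of_integral_mul_self h0] with y hy
  simpa [sub_eq_zero] using hy

/-- The restriction of an invariant measure to an almost invariant set is invariant. -/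
lemma smulInvariantMeasure_restrict {ν : Measure X} [SMulInvariantMeasure G X ν] {s : Set X}
    (hs : MeasurableSet s) (hinv : ∀ g : G, (g • ·) ⁻¹' s =ᵐ[ν] s) :
    SMulInvariantMeasure G X (ν.restrict s) := by
  refine ⟨fun g t ht => ?_⟩
  have hm : Measurable fun y : X => g • y := (continuous_const_smul g).measurable
  rw [Measure.restrict_apply (hm ht), Measure.restrict_apply ht,
    ← measure_preimage_smul_of_nullMeasurableSet (c := g) (ht.inter hs).nullMeasurableSet]
  refine measure_congr ?_
  rw [Set.preimage_inter]
  exact (ae_eq_refl _).inter (hinv g).symm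

theorem averaging_iff_ergodic (h : IsInvariantKernel G S μ) :
    (∀ f k : C(X, ℝ), S (f * S k) = S f * S k) ↔ ∀ x, ErgodicSMul G X (μ x : Measure X) := by
  constructor
  · intro hav x
    have hinv := h.invariant x
    refine { hinv with aeconst_of_forall_preimage_smul_ae_eq := fun {s} hs hsinv => ?_ }
    have hrestr := smulInvariantMeasure_restrict (G := G) hs hsinv
    -- The restriction is invariant, so `f` may be replaced by `S f`, which is almost everywhere the
    -- constant `S f x`. Evaluation at `s` then makes its mass equal to its own square.
    have heq : (μ x : Measure X).restrict s = (μ x : Measure X) s • (μ x : Measure X) := by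
      have : IsFiniteMeasure ((μ x : Measure X) s • (μ x : Measure X)) :=
        Measure.smul_finite _ (measure_ne_top _ _)
      refine measure_eq_of_forall_integral_eq fun f => ?_
      rw [← h.integral_eq _ inferInstance hrestr,
        integral_congr_ae (ae_restrict_of_ae (h.ae_eq_of_averaging hav x f)),
        integral_smul_measure, ← h.apply_eq]
      simp [Measure.real]
    have hsq : (μ x : Measure X) s = (μ x : Measure X) s * (μ x : Measure X) s := by
      have := congrArg (fun m : Measure X => m s) heq
      simpa using this
    rw [eventuallyConst_set]
    rcases eq_or_ne ((μ x : Measure X) s) 0 with h0 | h0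
    · right
      exact measure_eq_zero_iff_ae_notMem.1 h0
    · left
      have h1 : (μ x : Measure X) s = 1 :=
        ((ENNReal.mul_eq_left h0 (measure_ne_top _ _)).1 hsq.symm)
      exact (mem_ae_iff_prob_eq_one hs).2 h1
  · intro herg f k
    ext x
    rw [h.apply_eq, ContinuousMap.mul_apply, h.apply_eq f x, ← integral_mul_const]
    refine integral_congr_ae ?_
    filter_upwards [h.ae_eq_of_ergodic (herg x) k] with y hy
    rw [ContinuousMap.mul_apply, hy]

end IsInvariantKernel

/-- If all `S f` are invariant functions, they integrate to their value at `x` for every measure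
on the orbit closure of `x`. -/
lemma integral_eq_of_measure_compl_orbit {S : C(X, ℝ) →L[ℝ] C(X, ℝ)}
    (hS : ∀ (g : G) (f : C(X, ℝ)) (x : X), S f (g • x) = S f x) {x : X} {ν : Measure X}
    [IsProbabilityMeasure ν] (hν : ν (closure (MulAction.orbit G x))ᶜ = 0) (f : C(X, ℝ)) :
    ∫ y, S f y ∂ν = S f x := by
  have hsub : closure (MulAction.orbit G x) ⊆ {y | S f y = S f x} :=
    closure_minimal (by rintro _ ⟨g, rfl⟩; exact hS g f x)
      (isClosed_eq (S f).continuous continuous_const)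
  have hae : ∀ᵐ y ∂ν, S f y = S f x :=
    measure_mono_null (Set.compl_subset_compl.2 hsub) hν
  rw [integral_congr_ae hae]
  simp

/-- If all `S f` are invariant, an invariant `ν` on the orbit closure satisfies `∫ f ∂ν = ∫ S f ∂ν =
S f x`. Conversely, `x` and `g • x` share an orbit closure, so uniqueness identifies their measures.
-/
theorem IsInvariantKernel.koopman_iff_uniquelyErgodic (h : IsInvariantKernel G S μ)
    (hsupp : ∀ x, (μ x : Measure X) (closure (MulAction.orbit G x))ᶜ = 0) :
    (∀ (g : G) (f : C(X, ℝ)), koopman g (S f) = S f) ↔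
      ∀ x : X, IsUniquelyErgodicOrbitClosure G x := by
  constructor
  · intro hk x
    refine ⟨μ x, ⟨h.invariant x, hsupp x⟩, fun ν hν => ?_⟩
    refine ProbabilityMeasure.toMeasure_injective (measure_eq_of_forall_integral_eq fun f => ?_)
    have h₁ := integral_eq_of_measure_compl_orbit (G := G) (S := S)
      (fun g f x => DFunLike.congr_fun (hk g f) x) (ν := (ν : Measure X)) hν.2 f
    rw [h.integral_eq (ν : Measure X) inferInstance hν.1] at h₁
    exact h₁.trans (h.apply_eq f x)
  · intro hu g f
    ext x
    change S f (g • x) = S f x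
    have : μ (g • x) = μ x := (hu x).unique
      ⟨h.invariant _, by simpa [MulAction.orbit_smul] using hsupp (g • x)⟩
      ⟨h.invariant x, hsupp x⟩
    rw [h.apply_eq, h.apply_eq, this]

end Kernel

/-! ### The limit operator of Følner averages -/

section Folner

variable {G X : Type*} [Group G] [TopologicalSpace G] [IsTopologicalGroup G] [T2Space G]
  [MeasurableSpace G] [BorelSpace G]
  [MetricSpace X] [CompactSpace X] [MeasurableSpace X] [BorelSpace X]
  [MulAction G X] [ContinuousSMul G X] {θ : Measure G} {F : ℕ → Set G}
  {S : C(X, ℝ) →L[ℝ] C(X, ℝ)} {μ : X → ProbabilityMeasure X}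

/-- Orbit closures of amenable groups carry invariant measures. -/
theorem exists_invariant_of_isAmenable (hG : IsAmenable G) (x : X) :
    ∃ ν : ProbabilityMeasure X, SMulInvariantMeasure G X (ν : Measure X) ∧
      (ν : Measure X) (closure (MulAction.orbit G x))ᶜ = 0 := by
  obtain ⟨m, hpos, hone, hinv⟩ := hG
  -- The mean is transported along the orbit map; pulled-back functions are right uniformly
  -- continuous because `X` is compact and the action jointly continuous.
  let orb : C(G, X) := ⟨fun h => h • x, continuous_smul_const x⟩
  let pull : C(X, ℝ) →ₗ[ℝ] (G →ᵇ ℝ) :=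
    { toFun := fun f => (BoundedContinuousFunction.mkOfCompact f).compContinuous orb
      map_add' := fun _ _ => rfl
      map_smul' := fun _ _ => rfl }
  have hpull : ∀ f h, pull f h = f (h • x) := fun _ _ => rfl
  obtain ⟨ν, hν⟩ := exists_probabilityMeasure_of_nonneg (m.comp pull)
    (fun f hf => hpos _ fun h => hf (h • x)) (by
      rw [LinearMap.comp_apply, ← hone]
      rfl)
  refine ⟨ν, (smulInvariantMeasure_iff_integral_koopman _).2 fun g f => ?_, ?_⟩
  · rw [hν, hν, LinearMap.comp_apply, LinearMap.comp_apply, ← hinv (pull f) ?_ g]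
    · congr 1
      ext h
      change f (g • h • x) = f ((g * h) • x)
      rw [mul_smul]
    · intro ε hε
      obtain ⟨V, hVo, h1, hV⟩ := exists_isOpen_abs_smul_sub_lt (G := G) f hε
      refine ⟨V, hVo.mem_nhds h1, fun v hv h => ?_⟩
      rw [hpull, hpull, mul_smul]
      exact hV v hv _
  · refine measure_compl_eq_zero_of_forall_integral_eq_zero isClosed_closure
      ⟨x, subset_closure (MulAction.mem_orbit_self x)⟩ fun f hf => ?_
    have : pull f = 0 := by
      ext h
      exact hf _ (subset_closure (MulAction.mem_orbit x h))
    rw [hν, LinearMap.comp_apply, this, map_zero]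

lemma AveragesTendsto.measure_compl_orbit (hS : AveragesTendsto θ F S)
    (hμ : ∀ (f : C(X, ℝ)) (x : X), S f x = ∫ y, f y ∂(μ x : Measure X)) (x : X) :
    (μ x : Measure X) (closure (MulAction.orbit G x))ᶜ = 0 := by
  refine measure_compl_eq_zero_of_forall_integral_eq_zero isClosed_closure
    ⟨x, subset_closure (MulAction.mem_orbit_self x)⟩ fun f hf => ?_
  rw [← hμ]
  refine tendsto_nhds_unique (hS f x) (tendsto_const_nhds.congr fun n => ?_)
  have : ∀ g : G, f (g • x) = 0 := fun g => hf _ (subset_closure (MulAction.mem_orbit x g))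
  simp [folnerAverage, this]

lemma AveragesTendsto.invariant_of_left (hS : AveragesTendsto θ F S)
    (hμ : ∀ (f : C(X, ℝ)) (x : X), S f x = ∫ y, f y ∂(μ x : Measure X))
    (hl : ∀ (g : G) (f : C(X, ℝ)) (x : X), Tendsto (fun n =>
      folnerAverage θ F n (koopman g f) x - folnerAverage θ F n f x) atTop (𝓝 0)) (x : X) :
    SMulInvariantMeasure G X (μ x : Measure X) :=
  (smulInvariantMeasure_iff_integral_koopman _).2 fun g f => by
    rw [← hμ, ← hμ]
    exact sub_eq_zero.1 (tendsto_nhds_unique ((hS (koopman g f) x).sub (hS f x)) (hl g f x))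

/-- Amenability provides one invariant measure on the orbit closure; constancy of `S f` there forces
it to be `μ x`. -/
lemma AveragesTendsto.invariant_of_right (hG : IsAmenable G) (hF : IsAveraging θ F)
    (hS : AveragesTendsto θ F S)
    (hμ : ∀ (f : C(X, ℝ)) (x : X), S f x = ∫ y, f y ∂(μ x : Measure X))
    (hr : ∀ (g : G) (f : C(X, ℝ)) (x : X), S f (g • x) = S f x) (x : X) :
    SMulInvariantMeasure G X (μ x : Measure X) := by
  obtain ⟨ν, hinv, hsupp⟩ := exists_invariant_of_isAmenable hG x
  have : (μ x : Measure X) = ν := measure_eq_of_forall_integral_eq fun f => by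
    rw [← hS.integral_eq hF (ν : Measure X) f, ← hμ]
    exact (integral_eq_of_measure_compl_orbit hr hsupp f).symm
  rwa [this]

lemma AveragesTendsto.apply_smul_of_tendsto (hS : AveragesTendsto θ F S)
    (hr : ∀ (g : G) (f : C(X, ℝ)) (x : X), Tendsto (fun n =>
      folnerAverage θ F n f (g • x) - folnerAverage θ F n f x) atTop (𝓝 0))
    (g : G) (f : C(X, ℝ)) (x : X) : S f (g • x) = S f x :=
  sub_eq_zero.1 (tendsto_nhds_unique ((hS f (g • x)).sub (hS f x)) (hr g f x))

lemma IsFolner.isAveraging (hF : IsFolner θ F) : IsAveraging θ F := by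
  rcases hF with hF | hF | ⟨rfl, hfin, hne, -⟩ | ⟨rfl, hfin, hne, -⟩ | ⟨rfl, hfin, hne, -⟩
  · exact hF.isAveraging
  · exact hF.isAveraging
  all_goals exact isAveraging_count hfin hne

lemma IsAveraging.comp (hF : IsAveraging θ F) (φ : ℕ → ℕ) : IsAveraging θ (F ∘ φ) :=
  ⟨fun n => hF.measurableSet (φ n), fun n => hF.ne_zero (φ n), fun n => hF.ne_top (φ n)⟩

lemma IsAdmissibleFolner.comp (hF : IsAdmissibleFolner θ F) {φ : ℕ → ℕ} (hφ : StrictMono φ) :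
    IsAdmissibleFolner θ (F ∘ φ) := by
  have hφ' := hφ.tendsto_atTop
  rcases hF with hF | hF | hF | hF | ⟨hF, hG⟩
  · exact Or.inl ⟨hF.1, hF.2, fun n => hF.3 _, fun n => hF.4 _, fun n => hF.5 _,
      fun K hK hne => (hF.tendsto K hK hne).comp hφ'⟩
  · exact Or.inr (Or.inl ⟨hF.1, hF.2, fun n => hF.3 _, fun n => hF.4 _, fun n => hF.5 _,
      fun K hK hne => (hF.tendsto K hK hne).comp hφ'⟩)
  · exact Or.inr (Or.inr (Or.inl ⟨hF.1, fun n => hF.2 _, fun n => hF.3 _,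
      fun g V hV h1 => (hF.tendsto g V hV h1).comp hφ'⟩))
  · exact Or.inr (Or.inr (Or.inr (Or.inl ⟨hF.1, fun n => hF.2 _, fun n => hF.3 _,
      fun g V hV h1 => (hF.tendsto g V hV h1).comp hφ'⟩)))
  · exact Or.inr (Or.inr (Or.inr (Or.inr ⟨⟨hF.1, fun n => hF.2 _, fun n => hF.3 _,
      fun g V hV h1 => (hF.tendsto g V hV h1).comp hφ'⟩, hG⟩)))

theorem IsAdmissibleFolner.isInvariantKernel (hF : IsAdmissibleFolner θ F) (hG : IsAmenable G)
    (hav : IsAveraging θ F) (hS : AveragesTendsto θ F S)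
    (hμ : ∀ (f : C(X, ℝ)) (x : X), S f x = ∫ y, f y ∂(μ x : Measure X)) :
    IsInvariantKernel G S μ := by
  refine ⟨hμ, ?_, fun ν _ _ f => hS.integral_eq hav ν f⟩
  rcases hF with hF | hF | hF | hF | ⟨hF, hlc⟩
  · exact hS.invariant_of_left hμ hF.tendsto_koopman_sub
  · exact hS.invariant_of_right hG hav hμ (hS.apply_smul_of_tendsto hF.tendsto_smul_sub)
  · exact hS.invariant_of_left hμ hF.tendsto_koopman_sub
  · exact hS.invariant_of_right hG hav hμ (hS.apply_smul_of_tendsto hF.tendsto_smul_sub)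
  · exact hS.invariant_of_right hG hav hμ (hF.apply_smul hS)

end Folner

end FolnerAverages

open FolnerAverages in
theorem theorem3p15 {G X : Type*}
    [Group G] [TopologicalSpace G] [IsTopologicalGroup G] [T2Space G]
    [MeasurableSpace G] [BorelSpace G]
    [MetricSpace X] [CompactSpace X] [MeasurableSpace X] [BorelSpace X]
    [MulAction G X] [ContinuousSMul G X]
    (hG : IsAmenable G) (θ : Measure G) (F : ℕ → Set G) (hF : IsFolner θ F) :
    (IsWeaklyMeanEquicontinuous X θ F →
      ∃ (φ : ℕ → ℕ) (S : C(X, ℝ) →L[ℝ] C(X, ℝ)),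
        StrictMono φ ∧ AveragesTendsto θ (F ∘ φ) S) ∧
    (∀ (φ : ℕ → ℕ) (S : C(X, ℝ) →L[ℝ] C(X, ℝ)),
      StrictMono φ → AveragesTendsto θ (F ∘ φ) S →
        IsWeaklyMeanEquicontinuous X θ (F ∘ φ) ∧
        (∀ f : C(X, ℝ), 0 ≤ f → 0 ≤ S f) ∧ S 1 ≤ 1 ∧ ‖S‖ ≤ 1 ∧
        ∃ μ : X → ProbabilityMeasure X,
          Continuous μ ∧
          (∀ x, IsGeneric θ (F ∘ φ) x (μ x : Measure X)) ∧
          (∀ (f : C(X, ℝ)) (x : X), S f x = ∫ y, f y ∂(μ x : Measure X)) ∧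
          (IsAdmissibleFolner θ F →
            (∀ f : C(X, ℝ), S (S f) = S f) ∧
            (∀ f h : C(X, ℝ), S (f * S h) = S (S f * S h)) ∧
            ((∀ f h : C(X, ℝ), S (f * S h) = S f * S h) ↔
              ∀ x, ErgodicSMul G X (μ x : Measure X)) ∧
            ((∀ (g : G) (f : C(X, ℝ)), koopman g (S f) = S f) ↔
              ∀ x : X, IsUniquelyErgodicOrbitClosure G x))) := by
  have hav := hF.isAveraging
  refine ⟨exists_subseq_averagesTendsto hav, fun φ S hφ hS => ?_⟩
  have havφ := hav.comp φ
  obtain ⟨μ, hμc, hμ⟩ := hS.exists_measure havφ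
  refine ⟨hS.isWeaklyMeanEquicontinuous havφ hμc hμ, fun f hf => hS.nonneg hf,
    (hS.map_one havφ).le, hS.norm_le_one havφ, μ, hμc, fun x f => hμ f x ▸ hS f x, hμ,
    fun hadm => ?_⟩
  have hker := (hadm.comp hφ).isInvariantKernel hG havφ hS hμ
  exact ⟨hker.idempotent, hker.seever, hker.averaging_iff_ergodic,
    hker.koopman_iff_uniquelyErgodic (hS.measure_compl_orbit hμ)⟩
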